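/- Let $\Lambda\in\mathbb{R}^{n\times n}$ be diagonal and positive definite, let $H\in\mathbb{R}^{n\times n}$, $B\in\mathbb{R}^{n\times m}$, $K\in\mathbb{R}^{m\times n}$, $\alpha>0$, and consider the linear hyperbolic system with boundary control, disturbed output $y$ and dynamic controller $$X_t(z,t)+\Lambda X_z(z,t)=0,\quad X(z,0)=X^0(z),\quad X(0,t)=HX(1,t)+Bu(t),\quad y(t)=X(1,t)+d(t),$$ $$\dot\eta(t)=-\alpha(\eta(t)-y(t)),\quad \eta(0)=\eta^0,\quad u(t)=K\eta(t),\qquad z\in[0,1],\ t\ge 0,$$ where $d:[0,\infty)\to\mathbb{R}^n$ is measurable and locally essentially bounded. Solutions are weak solutions $(X,\eta)\in \mathcal{C}^0([0,\infty);\mathcal{H}^1((0,1);\mathbb{R}^n)\times\mathbb{R}^n)$: the partial differential equation holds in the sense of distributions, the boundary and initial conditions hold pointwise, and the differential equation for $\eta$ holds in integrated form. Assume that there are scalars $\mu,\nu,\zeta>0$, a diagonal positive definite matrix $D\in\mathbb{R}^{n\times n}$ and constants $\beta_1,\beta_2,\beta_3>0$ such that $$\|D(H+BK)D^{-1}\|_2\le\nu<1,\qquad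 \Omega>\zeta I,$$ where $\|\cdot\|_2$ is the induced Euclidean norm and, with $\rho:=e^{-\mu}-\nu^2$, $F:=BK$, $Q:=F^\top D^2F$, $G:=H^\top D^2F$, $$\Omega:=\begin{bmatrix}\rho\beta_1D^2 & -\beta_1(G+Q) & 0\\ * & 2\alpha\beta_3 I-(\beta_1+\alpha^2\beta_2)Q & \beta_3I+\alpha\beta_2G^\top\\ * & * & (\rho D^2+Q+G+G^\top)\beta_2\end{bmatrix}$$ ($*$ denotes the transposed block). Then there are constants $a,c>0$ and a function $\gamma$ of class $\mathcal{K}_\infty$, not depending on $d$, $X^0$, $\eta^0$ or the solution, such that every solution satisfies, for all $t\ge 0$, $$\max_{z\in[0,1]}|X(z,t)|\le c\,e^{-at}\sqrt{M_{X^0}}+\gamma\big(\|d_{[0,t]}\|_\infty\big),\qquad M_{X^0}:=\|X^0\|^2_{\mathcal{H}^1((0,1);\mathbb{R}^n)}+|\eta^0-X(1,0)|^2,$$ where $\|X^0\|^2_{\mathcal{H}^1}=\|X^0\|^2_{\mathcal{L}^2}+\|\partial X^0\|^2_{\mathcal{L}^2}$ and $\|d_{[0,t]}\|_\infty$ is the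 essential supremum of $|d|$ over $[0,t]$. -/

import Mathlib

open MeasureTheory Set Filter Topology
open scoped Matrix ENNReal ContDiff
open scoped Matrix.Norms.L2Operator

noncomputable section

namespace HyperbolicDSS

/-- `γ : [0, ∞) → [0, ∞)` is of class `𝒦_∞`: continuous, strictly increasing, zero at zero and
unbounded. Only the values on `[0, ∞)` matter. -/
structure IsClassKInfty (γ : ℝ → ℝ) : Prop where
  continuousOn : ContinuousOn γ (Ici 0)
  strictMonoOn : StrictMonoOn γ (Ici 0)
  map_zero : γ 0 = 0
  tendsto_atTop : Tendsto γ atTop atTop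

/-- `‖d_{[0,t]}‖_∞`, the essential supremum of `|d(s)|` over `s ∈ [0, t]`. -/
def essSupNorm {n : ℕ} (d : ℝ → EuclideanSpace ℝ (Fin n)) (t : ℝ) : ℝ :=
  (eLpNorm d ∞ (volume.restrict (Icc 0 t))).toReal

/-- `g ∈ L²((0,1); ℝⁿ)` is a weak derivative of `f` on `(0,1)`. -/
def IsWeakDeriv {n : ℕ} (f g : ℝ → EuclideanSpace ℝ (Fin n)) : Prop :=
  MemLp g 2 (volume.restrict (Ioo 0 1)) ∧
    ∀ φ : ℝ → ℝ, ContDiff ℝ ∞ φ → HasCompactSupport φ → tsupport φ ⊆ Ioo 0 1 →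
      ∫ z in Ioo (0 : ℝ) 1, deriv φ z • f z = -∫ z in Ioo (0 : ℝ) 1, φ z • g z

/-- `f ∈ C⁰([0,1]; ℝⁿ) ∩ H¹((0,1); ℝⁿ)`: an element of `H¹((0,1); ℝⁿ)`, given by its continuous
representative on `[0,1]`, so that the boundary values are `f 0` and `f 1`. -/
def MemH1 {n : ℕ} (f : ℝ → EuclideanSpace ℝ (Fin n)) : Prop :=
  ContinuousOn f (Icc 0 1) ∧ ∃ g, IsWeakDeriv f g

open Classical in
/-- The weak derivative `∂f` in `L²((0,1); ℝⁿ)` (unique up to null sets; zero if there is none). -/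
def weakDeriv {n : ℕ} (f : ℝ → EuclideanSpace ℝ (Fin n)) : ℝ → EuclideanSpace ℝ (Fin n) :=
  if h : ∃ g, IsWeakDeriv f g then h.choose else 0

/-- The squared `H¹` norm `‖f‖²_{L²((0,1); ℝⁿ)} + ‖∂f‖²_{L²((0,1); ℝⁿ)}`. -/
def h1NormSq {n : ℕ} (f : ℝ → EuclideanSpace ℝ (Fin n)) : ℝ :=
  (∫ z in Ioo (0 : ℝ) 1, ‖f z‖ ^ 2) + ∫ z in Ioo (0 : ℝ) 1, ‖weakDeriv f z‖ ^ 2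

/-- Weak solutions `(X, η) ∈ C⁰([0, ∞); H¹((0,1); ℝⁿ) × ℝⁿ)` of the closed loop
`X_t + Λ X_z = 0`, `X(0,t) = H X(1,t) + B u(t)`, `y(t) = X(1,t) + d(t)`,
`η' = -α (η - y)`, `u = K η`, `X(·,0) = X⁰`, `η(0) = η⁰`.
Here `X t z` stands for `X(z,t)`. -/
structure IsSolution {n m : ℕ} (Λ H : Matrix (Fin n) (Fin n) ℝ) (B : Matrix (Fin n) (Fin m) ℝ)
    (K : Matrix (Fin m) (Fin n) ℝ) (α : ℝ) (d : ℝ → EuclideanSpace ℝ (Fin n))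
    (X₀ : ℝ → EuclideanSpace ℝ (Fin n)) (η₀ : EuclideanSpace ℝ (Fin n))
    (X : ℝ → ℝ → EuclideanSpace ℝ (Fin n)) (η : ℝ → EuclideanSpace ℝ (Fin n)) : Prop where
  /-- `X(·,t) ∈ H¹((0,1); ℝⁿ)` for every `t ≥ 0` -/
  memH1 : ∀ t, 0 ≤ t → MemH1 (X t)
  /-- `t ↦ X(·,t)` is continuous on `[0, ∞)` for the `H¹` norm -/
  continuous_h1 : ∀ s, 0 ≤ s →
    Tendsto (fun t => h1NormSq (fun z => X t z - X s z)) (𝓝[Ici 0] s) (𝓝 0)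
  /-- `X_t + Λ X_z = 0` in the sense of distributions on `(0,1) × (0, ∞)` -/
  pde : ∀ φ : ℝ → ℝ → ℝ, ContDiff ℝ ∞ (Function.uncurry φ) →
    HasCompactSupport (Function.uncurry φ) →
    tsupport (Function.uncurry φ) ⊆ Ioi 0 ×ˢ Ioo 0 1 →
    ∫ t in Ioi (0 : ℝ), ∫ z in Ioo (0 : ℝ) 1,
      (deriv (fun s => φ s z) t • X t z
        + deriv (fun x => φ t x) z • Matrix.toEuclideanLin Λ (X t z)) = 0
  /-- the boundary condition, with `u = K η` -/
  boundary : ∀ t, 0 ≤ t → X t 0 = Matrix.toEuclideanLin H (X t 1)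
    + Matrix.toEuclideanLin B (Matrix.toEuclideanLin K (η t))
  continuousOn_η : ContinuousOn η (Ici 0)
  /-- the controller `η' = -α (η - y)`, `η(0) = η⁰`, in integrated (Carathéodory) form -/
  controller : ∀ t, 0 ≤ t → η t = η₀ + ∫ s in (0 : ℝ)..t, (-α) • (η s - (X s 1 + d s))
  initial : ∀ z ∈ Icc (0 : ℝ) 1, X 0 z = X₀ z

/-- The symmetric matrix `Ω`, with `ρ = e^{-μ} - ν²`, `F = B K`, `Q = Fᵀ D² F`, `G = Hᵀ D² F`. -/
def Omega {n m : ℕ} (H : Matrix (Fin n) (Fin n) ℝ) (B : Matrix (Fin n) (Fin m) ℝ)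
    (K : Matrix (Fin m) (Fin n) ℝ) (D : Matrix (Fin n) (Fin n) ℝ) (μ ν α β₁ β₂ β₃ : ℝ) :
    Matrix (Fin n ⊕ Fin n ⊕ Fin n) (Fin n ⊕ Fin n ⊕ Fin n) ℝ :=
  let ρ : ℝ := Real.exp (-μ) - ν ^ 2
  let F : Matrix (Fin n) (Fin n) ℝ := B * K
  let Q : Matrix (Fin n) (Fin n) ℝ := Fᵀ * D ^ 2 * F
  let G : Matrix (Fin n) (Fin n) ℝ := Hᵀ * D ^ 2 * F
  let Ω₁₁ : Matrix (Fin n) (Fin n) ℝ := (ρ * β₁) • D ^ 2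
  let Ω₁₂ : Matrix (Fin n) (Fin n) ℝ := -(β₁ • (G + Q))
  let Ω₂₂ : Matrix (Fin n) (Fin n) ℝ := (2 * α * β₃) • 1 - (β₁ + α ^ 2 * β₂) • Q
  let Ω₂₃ : Matrix (Fin n) (Fin n) ℝ := β₃ • 1 + (α * β₂) • Gᵀ
  let Ω₃₃ : Matrix (Fin n) (Fin n) ℝ := β₂ • (ρ • D ^ 2 + Q + G + Gᵀ)
  Matrix.fromBlocks Ω₁₁ (Matrix.fromCols Ω₁₂ 0) (Matrix.fromRows Ω₁₂ᵀ 0)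
    (Matrix.fromBlocks Ω₂₂ Ω₂₃ Ω₂₃ᵀ Ω₃₃)

end HyperbolicDSS

end

noncomputable section

namespace HyperbolicDSS

/-! ### Absolutely continuous functions with a prescribed almost everywhere derivative -/

/-! The transport equation is solved by characteristics. Component `i` of a weak solution is `ψ i (t
- z / l i)`, where `l i` is the `i`-th diagonal entry of `Λ` and the trace `ψ i` is one function of
time. Everything then reduces to a delay system: the outflow is `ψ i (t - 1 / l i)`, the boundary
condition expresses `ψ i t` through outflow and `η`, and its time derivative expresses `ψ'` through
the delayed `ψ'` and `η'`.

The Lyapunov functional is a weighted H¹ energy plus `β₃ |η - X(1,t)|²`. The energy is written as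
integrals of `β₁ ψ² + β₂ ψ'²` over the windows `[t - 1 / l i, t]`, with weight `e^{-μ z}` at `z = l
i (t - s)`. Each window integral is absolutely continuous although `ψ'` is only square integrable,
so the functional can be differentiated almost everywhere without second derivatives of `X`. Its
derivative consists of the densities at the two ends of the window and a decay term of rate `μ * l
i`.

With `x = X(1,t)`, `e = η - x`, `w = X_t(1,t)`, the end terms and the derivative of the controller
term are at most minus the quadratic form of `Ω` plus terms containing `d`. The contraction
`‖D(H+BK)D⁻¹‖ ≤ ν` bounds the part of the inflow that is not caused by `e` or `d`, and the margin
`ζ` absorbs the products with `d` (`dissipation_inequality`).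

Gronwall's inequality gives exponential decay of the functional up to a multiple of `‖d‖²_∞`
(`lyapunov_decay`). It dominates `max |X|²` by the one-dimensional Sobolev inequality, and its
initial value is bounded by the data. Taking square roots yields a linear `γ`. -/

theorem absolutelyContinuousOnInterval_congr {f g : ℝ → ℝ} {a b : ℝ}
    (hf : AbsolutelyContinuousOnInterval f a b) (h : EqOn f g (uIcc a b)) :
    AbsolutelyContinuousOnInterval g a b := by
  rw [absolutelyContinuousOnInterval_iff] at hf ⊢
  intro ε hε
  obtain ⟨δ, hδ, H⟩ := hf ε hε
  refine ⟨δ, hδ, fun E hE hlt => ?_⟩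
  have := H E hE hlt
  refine lt_of_eq_of_lt (Finset.sum_congr rfl fun i hi => ?_) this
  rw [h (hE.1 i hi).1, h (hE.1 i hi).2]

/-- `f` is absolutely continuous on `[a, b]` with almost everywhere derivative `f'`. -/
structure HasACDeriv (f f' : ℝ → ℝ) (a b : ℝ) : Prop where
  ac : AbsolutelyContinuousOnInterval f a b
  hasDerivAt : ∀ᵐ x, x ∈ Ioo a b → HasDerivAt f (f' x) x

namespace HasACDeriv

variable {f f' g g' : ℝ → ℝ} {a b c : ℝ}

theorem congr (hf : HasACDeriv f f' a b) (hab : a ≤ b) (h : EqOn f g (Icc a b)) :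
    HasACDeriv g f' a b := by
  refine ⟨absolutelyContinuousOnInterval_congr hf.ac (by rwa [uIcc_of_le hab]), ?_⟩
  filter_upwards [hf.hasDerivAt] with x hx hxI
  refine (hx hxI).congr_of_eventuallyEq ?_
  filter_upwards [Icc_mem_nhds hxI.1 hxI.2] with y hy
  exact (h hy).symm

theorem congr_deriv (hf : HasACDeriv f f' a b) (h : ∀ᵐ x, x ∈ Ioo a b → f' x = g' x) :
    HasACDeriv f g' a b := by
  refine ⟨hf.ac, ?_⟩
  filter_upwards [hf.hasDerivAt, h] with x hx h hxI
  exact h hxI ▸ hx hxI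

theorem deriv_ae_eq (hf : HasACDeriv f f' a b) : ∀ᵐ x, x ∈ Ioo a b → deriv f x = f' x := by
  filter_upwards [hf.hasDerivAt] with x hx hxI
  exact (hx hxI).deriv

theorem mono (hf : HasACDeriv f f' a b) {c d : ℝ} (hac : a ≤ c) (hcd : c ≤ d) (hdb : d ≤ b) :
    HasACDeriv f f' c d := by
  refine ⟨hf.ac.mono ?_, ?_⟩
  · rw [uIcc_of_le hcd, uIcc_of_le (hac.trans (hcd.trans hdb))]
    exact Icc_subset_Icc hac hdb
  · filter_upwards [hf.hasDerivAt] with x hx hxI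
    exact hx (Ioo_subset_Ioo hac hdb hxI)

theorem continuousOn (hf : HasACDeriv f f' a b) (hab : a ≤ b) : ContinuousOn f (Icc a b) := by
  simpa [uIcc_of_le hab] using hf.ac.continuousOn

theorem ae_uIoc_of_ae_Ioo {p : ℝ → Prop} (hab : a ≤ b) (h : ∀ᵐ x, x ∈ Ioo a b → p x) :
    ∀ᵐ x, x ∈ uIoc a b → p x := by
  have hb : ∀ᵐ x : ℝ, x ≠ b := by simp [ae_iff, measure_singleton]
  filter_upwards [h, hb] with x hx hxb hxI
  rw [uIoc_of_le hab] at hxI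
  exact hx ⟨hxI.1, lt_of_le_of_ne hxI.2 hxb⟩

theorem intervalIntegrable (hf : HasACDeriv f f' a b) (hab : a ≤ b) :
    IntervalIntegrable f' volume a b := by
  refine hf.ac.intervalIntegrable_deriv.congr_ae ?_
  rw [Filter.EventuallyEq, ae_restrict_iff' measurableSet_uIoc]
  exact ae_uIoc_of_ae_Ioo hab hf.deriv_ae_eq

theorem integral_eq_sub (hf : HasACDeriv f f' a b) (hab : a ≤ b) :
    ∫ x in a..b, f' x = f b - f a := by
  rw [← hf.ac.integral_deriv_eq_sub]
  refine intervalIntegral.integral_congr_ae ?_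
  filter_upwards [ae_uIoc_of_ae_Ioo hab hf.deriv_ae_eq] with x hx hxI
  exact (hx hxI).symm

theorem eq_add_integral (hf : HasACDeriv f f' a b) {x : ℝ} (hx : x ∈ Icc a b) :
    f x = f a + ∫ s in a..x, f' s := by
  rw [(hf.mono le_rfl hx.1 hx.2).integral_eq_sub hx.1]; ring

/-- Lebesgue's differentiation theorem; together with `eq_add_integral` it makes the integral
formula an equivalent description. -/
theorem of_integral (hab : a ≤ b) (hf' : IntervalIntegrable f' volume a b)
    (h : ∀ x ∈ Icc a b, f x = c + ∫ s in a..x, f' s) : HasACDeriv f f' a b := by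
  have hI : HasACDeriv (fun x => ∫ s in a..x, f' s) f' a b := by
    refine ⟨hf'.absolutelyContinuousOnInterval_intervalIntegral left_mem_uIcc, ?_⟩
    filter_upwards [hf'.ae_hasDerivAt_integral] with x hx hxI
    exact hx (by rw [uIcc_of_le hab]; exact Ioo_subset_Icc_self hxI) a left_mem_uIcc
  have hc : HasACDeriv (fun x => c + ∫ s in a..x, f' s) f' a b := by
    refine ⟨AbsolutelyContinuousOnInterval.fun_add ?_ hI.ac, ?_⟩
    · exact (contDiff_const.contDiffOn).absolutelyContinuousOnInterval
    · filter_upwards [hI.hasDerivAt] with x hx hxI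
      exact (hx hxI).const_add c
  exact hc.congr hab fun x hx => (h x hx).symm

theorem of_hasDerivAt (hf' : Continuous f') (h : ∀ x, HasDerivAt f (f' x) x) :
    HasACDeriv f f' a b := by
  refine ⟨ContDiffOn.absolutelyContinuousOnInterval (ContDiff.contDiffOn ?_),
    ae_of_all _ fun x _ => h x⟩
  rw [contDiff_one_iff_deriv]
  exact ⟨fun x => (h x).differentiableAt, by rwa [funext fun x => (h x).deriv]⟩

theorem add (hf : HasACDeriv f f' a b) (hg : HasACDeriv g g' a b) :
    HasACDeriv (fun x => f x + g x) (fun x => f' x + g' x) a b := by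
  refine ⟨hf.ac.fun_add hg.ac, ?_⟩
  filter_upwards [hf.hasDerivAt, hg.hasDerivAt] with x h1 h2 hx
  exact (h1 hx).add (h2 hx)

theorem sub (hf : HasACDeriv f f' a b) (hg : HasACDeriv g g' a b) :
    HasACDeriv (fun x => f x - g x) (fun x => f' x - g' x) a b := by
  refine ⟨hf.ac.fun_sub hg.ac, ?_⟩
  filter_upwards [hf.hasDerivAt, hg.hasDerivAt] with x h1 h2 hx
  exact (h1 hx).sub (h2 hx)

theorem mul (hf : HasACDeriv f f' a b) (hg : HasACDeriv g g' a b) :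
    HasACDeriv (fun x => f x * g x) (fun x => f' x * g x + f x * g' x) a b := by
  refine ⟨hf.ac.fun_mul hg.ac, ?_⟩
  filter_upwards [hf.hasDerivAt, hg.hasDerivAt] with x h1 h2 hx
  exact (h1 hx).mul (h2 hx)

theorem const (c : ℝ) : HasACDeriv (fun _ => c) (fun _ => 0) a b :=
  of_hasDerivAt continuous_const fun x => hasDerivAt_const x c

theorem const_mul (c : ℝ) (hf : HasACDeriv f f' a b) :
    HasACDeriv (fun x => c * f x) (fun x => c * f' x) a b := by
  refine ⟨hf.ac.const_mul c, ?_⟩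
  filter_upwards [hf.hasDerivAt] with x h1 hx
  exact (h1 hx).const_mul c

theorem sum {ι : Type*} (s : Finset ι) {f f' : ι → ℝ → ℝ}
    (h : ∀ i ∈ s, HasACDeriv (f i) (f' i) a b) :
    HasACDeriv (fun x => ∑ i ∈ s, f i x) (fun x => ∑ i ∈ s, f' i x) a b := by
  classical
  induction s using Finset.induction_on with
  | empty => simpa using const 0
  | insert i s hi ih =>
    simp only [Finset.sum_insert hi]
    exact (h i (Finset.mem_insert_self _ _)).add
      (ih fun j hj => h j (Finset.mem_insert_of_mem hj))

theorem le_of_deriv_nonpos (hf : HasACDeriv f f' a b) (hab : a ≤ b)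
    (h : ∀ᵐ x, x ∈ Ioo a b → f' x ≤ 0) : f b ≤ f a := by
  have := hf.integral_eq_sub hab
  have h2 : ∫ x in a..b, f' x ≤ 0 := by
    rw [intervalIntegral.integral_of_le hab]
    refine integral_nonpos_of_ae ?_
    rw [Filter.EventuallyLE, ae_restrict_iff' measurableSet_Ioc]
    simpa [uIoc_of_le hab] using ae_uIoc_of_ae_Ioo hab h
  linarith

theorem glue (hf : HasACDeriv f f' a b) (hg : HasACDeriv f f' b c) (hab : a ≤ b) (hbc : b ≤ c) :
    HasACDeriv f f' a c := by
  have h1 := hf.intervalIntegrable hab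
  have h2 := hg.intervalIntegrable hbc
  refine of_integral (c := f a) (hab.trans hbc) (h1.trans h2) fun x hx => ?_
  rcases le_total x b with hxb | hxb
  · exact hf.eq_add_integral ⟨hx.1, hxb⟩
  · have h3 := (hg.mono le_rfl hxb hx.2).intervalIntegrable hxb
    rw [← intervalIntegral.integral_add_adjacent_intervals h1 h3, hf.integral_eq_sub hab,
      (hg.mono le_rfl hxb hx.2).integral_eq_sub hxb]
    ring

theorem comp_sub_const (hf : HasACDeriv f f' a b) (hab : a ≤ b) (τ : ℝ) :
    HasACDeriv (fun t => f (t - τ)) (fun t => f' (t - τ)) (a + τ) (b + τ) := by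
  refine of_integral (c := f a) (by linarith) ?_ fun x hx => ?_
  · exact (hf.intervalIntegrable hab).comp_sub_right τ
  · rw [intervalIntegral.integral_comp_sub_right (fun s => f' s) τ, add_sub_cancel_right]
    exact hf.eq_add_integral ⟨by linarith [hx.1], by linarith [hx.2]⟩

/-- This substitution turns a spatial profile at time `t` into a function of the departure time `s`
from `z = 0`. It reverses orientation, so the left endpoint carries the value `f b`. -/
theorem comp_affine (hf : HasACDeriv f f' a b) (hab : a ≤ b) {l : ℝ} (hl : 0 < l) (t : ℝ) :
    HasACDeriv (fun s => f (l * (t - s))) (fun s => -l * f' (l * (t - s)))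
      (t - b / l) (t - a / l) := by
  have hq : Tendsto (fun s : ℝ => l * (t - s)) (ae volume) (ae volume) := by
    have : Measure.QuasiMeasurePreserving (fun s : ℝ => l * (t - s)) volume volume := by
      have h1 : Measure.QuasiMeasurePreserving (fun s : ℝ => t - s) volume volume :=
        (Measure.measurePreserving_sub_left volume t).quasiMeasurePreserving
      have h2 : Measure.QuasiMeasurePreserving (fun s : ℝ => l * s) volume volume := by
        refine ⟨measurable_const_mul l, ?_⟩
        rw [Real.map_volume_mul_left hl.ne']
        exact Measure.smul_absolutelyContinuous
      exact h2.comp h1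
    exact this.tendsto_ae
  have hle : t - b / l ≤ t - a / l := by
    have : a / l ≤ b / l := by gcongr
    linarith
  have hint : IntervalIntegrable (fun s => -l * f' (l * (t - s))) volume (t - b / l)
      (t - a / l) := by
    have h1 := (hf.intervalIntegrable hab).comp_mul_left (c := l)
    have h2 := (h1.comp_sub_left t).symm
    exact h2.const_mul (-l)
  refine of_integral (c := f b) hle hint fun x hx => ?_
  have hx1 : l * (t - x) ≤ b := by
    have := hx.1
    have h3 : t - x ≤ b / l := by linarith
    rw [le_div_iff₀ hl] at h3; linarith
  have hx2 : a ≤ l * (t - x) := by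
    have h3 : a / l ≤ t - x := by linarith [hx.2]
    rw [div_le_iff₀ hl] at h3; linarith
  rw [intervalIntegral.integral_const_mul]
  have h4 : ∫ s in (t - b / l)..x, f' (l * (t - s)) = l⁻¹ • ∫ s in (l * (t - x))..b, f' s := by
    have h5 := intervalIntegral.integral_comp_sub_left (fun s => f' (l * s)) t
      (a := t - b / l) (b := x)
    rw [h5, intervalIntegral.integral_comp_mul_left _ hl.ne']
    congr 2
    rw [sub_sub_cancel, mul_div_cancel₀ _ hl.ne']
  rw [h4, (hf.mono hx2 hx1 le_rfl).integral_eq_sub hx1, smul_eq_mul]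
  field_simp
  ring

/-- Two values of `f` differ by at most `∫ |f'|`, which Cauchy–Schwarz bounds by the L² norm of
`f'`; averaging over the second point gives the claim. -/
theorem sq_le (hf : HasACDeriv f f' a b) (hab : a < b)
    (hf' : IntervalIntegrable (fun s => f' s ^ 2) volume a b) {x : ℝ} (hx : x ∈ Icc a b) :
    f x ^ 2 ≤ 2 / (b - a) * (∫ s in a..b, f s ^ 2) + 2 * (b - a) * ∫ s in a..b, f' s ^ 2 := by
  have hL : 0 < b - a := sub_pos.2 hab
  have hi := hf.intervalIntegrable hab.le
  have hcs : (∫ s in a..b, |f' s|) ^ 2 ≤ (b - a) * ∫ s in a..b, f' s ^ 2 := by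
    -- Cauchy–Schwarz as nonnegativity of the variance of `|f'|` about its mean `m`.
    set m := (b - a)⁻¹ * ∫ s in a..b, |f' s| with hm
    have h0 : 0 ≤ ∫ s in a..b, (|f' s| - m) ^ 2 :=
      intervalIntegral.integral_nonneg hab.le fun _ _ => sq_nonneg _
    have h1 : ∫ s in a..b, (|f' s| - m) ^ 2
        = (∫ s in a..b, f' s ^ 2) - 2 * m * (∫ s in a..b, |f' s|) + m ^ 2 * (b - a) := by
      have h2 : (fun s => (|f' s| - m) ^ 2) = fun s => (f' s ^ 2 - (2 * m) * |f' s|) + m ^ 2 := by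
        funext s; rw [sub_sq, sq_abs]; ring
      rw [h2, intervalIntegral.integral_add (hf'.sub (hi.abs.const_mul _)) (by simp),
        intervalIntegral.integral_sub hf' (hi.abs.const_mul _),
        intervalIntegral.integral_const_mul, intervalIntegral.integral_const, smul_eq_mul]
      ring
    have h3 : (∫ s in a..b, |f' s|) = (b - a) * m := by rw [hm]; field_simp
    rw [h1, h3] at h0
    rw [h3]
    nlinarith
  have hpt : ∀ y ∈ Icc a b, f x ^ 2 ≤ 2 * f y ^ 2 + 2 * ((b - a) * ∫ s in a..b, f' s ^ 2) := by
    intro y hy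
    have hd : |f x - f y| ≤ ∫ s in a..b, |f' s| := by
      have key : ∀ u v, u ∈ Icc a b → v ∈ Icc a b → u ≤ v → |f v - f u| ≤ ∫ s in a..b, |f' s| := by
        intro u v hu hv huv
        rw [← (hf.mono hu.1 huv hv.2).integral_eq_sub huv]
        refine (intervalIntegral.abs_integral_le_integral_abs huv).trans ?_
        exact intervalIntegral.integral_mono_interval hu.1 huv hv.2
          (ae_of_all _ fun _ => abs_nonneg _) hi.abs
      rcases le_total x y with h | h
      · rw [abs_sub_comm]; exact key x y hx hy h
      · exact key y x hy hx h
    have h2 : (f x - f y) ^ 2 ≤ (∫ s in a..b, |f' s|) ^ 2 := by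
      rw [← sq_abs]; gcongr
    -- The square is the defect in `f x ^ 2 ≤ 2 * f y ^ 2 + 2 * (f x - f y) ^ 2`.
    nlinarith [sq_nonneg (f x - 2 * f y)]
  have hfi : IntervalIntegrable (fun s => f s ^ 2) volume a b := by
    apply ContinuousOn.intervalIntegrable
    rw [uIcc_of_le hab.le]
    exact (hf.continuousOn hab.le).pow 2
  have := intervalIntegral.integral_mono_on hab.le (by simp) ((hfi.const_mul 2).add
    (by simp : IntervalIntegrable (fun _ => 2 * ((b - a) * ∫ s in a..b, f' s ^ 2)) volume a b)) hpt
  rw [intervalIntegral.integral_const, smul_eq_mul, intervalIntegral.integral_add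
    (hfi.const_mul 2) (by simp), intervalIntegral.integral_const_mul,
    intervalIntegral.integral_const, smul_eq_mul] at this
  have h5 : 2 / (b - a) * (∫ s in a..b, f s ^ 2) + 2 * (b - a) * (∫ s in a..b, f' s ^ 2)
    = (2 * (∫ s in a..b, f s ^ 2) + (b - a) * (2 * ((b - a) * ∫ s in a..b, f' s ^ 2))) / (b - a) := by
    field_simp
  rw [h5, le_div_iff₀ hL]
  linarith

end HasACDeriv

/-- The derivative of an exponentially weighted integral over a sliding window. -/
theorem hasACDeriv_window {k : ℝ → ℝ} {τ T c : ℝ} (hτ : 0 ≤ τ) (hT : 0 ≤ T)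
    (hk : IntervalIntegrable k volume (-τ) T) :
    HasACDeriv (fun t => Real.exp (-(c * t)) * ∫ s in (t - τ)..t, Real.exp (c * s) * k s)
      (fun t => k t - Real.exp (-(c * τ)) * k (t - τ)
        - c * (Real.exp (-(c * t)) * ∫ s in (t - τ)..t, Real.exp (c * s) * k s)) 0 T := by
  set h : ℝ → ℝ := fun s => Real.exp (c * s) * k s with hh
  have hhi : IntervalIntegrable h volume (-τ) T :=
    hk.continuousOn_mul (by fun_prop)
  have hτT : -τ ≤ T := by linarith
  have hF : HasACDeriv (fun t => ∫ s in (-τ)..t, h s) h (-τ) T :=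
    HasACDeriv.of_integral (c := 0) hτT hhi fun x _ => by simp
  have hF1 := hF.mono (by linarith : -τ ≤ 0) hT le_rfl
  have hF2 := (hF.mono le_rfl (by linarith : -τ ≤ T - τ) (by linarith)).comp_sub_const
    (by linarith) τ
  simp only [neg_add_cancel, sub_add_cancel] at hF2
  have hW : HasACDeriv (fun t => ∫ s in (t - τ)..t, h s) (fun t => h t - h (t - τ)) 0 T := by
    refine (hF1.sub hF2).congr hT fun t ht => ?_
    have hsub : ∀ u ∈ Icc (-τ) T, IntervalIntegrable h volume (-τ) u := fun u hu =>
      (hF.mono le_rfl hu.1 hu.2).intervalIntegrable hu.1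
    exact intervalIntegral.integral_interval_sub_left (hsub t ⟨by linarith [ht.1], ht.2⟩)
      (hsub (t - τ) ⟨by linarith [ht.1], by linarith [ht.2]⟩)
  have hE : HasACDeriv (fun t => Real.exp (-(c * t))) (fun t => -c * Real.exp (-(c * t))) 0 T := by
    refine HasACDeriv.of_hasDerivAt (by fun_prop) fun x => ?_
    have : HasDerivAt (fun t : ℝ => -(c * t)) (-c) x := by
      simpa using ((hasDerivAt_id' x).const_mul c).fun_neg
    simpa [mul_comm] using this.exp
  refine (hE.mul hW).congr_deriv (ae_of_all _ fun t _ => ?_)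
  -- The weight is `1` at the leading end of the window and `e^{-cτ}` at the trailing end.
  have e1 : Real.exp (-(c * t)) * Real.exp (c * t) = 1 := by rw [← Real.exp_add]; simp
  have e2 : Real.exp (-(c * t)) * Real.exp (c * (t - τ)) = Real.exp (-(c * τ)) := by
    rw [← Real.exp_add]; ring_nf
  have : Real.exp (-(c * t)) * (h t - h (t - τ)) = k t - Real.exp (-(c * τ)) * k (t - τ) := by
    simp only [hh]
    rw [← e2, mul_sub, ← mul_assoc, e1]; ring
  rw [this]; ring

end HyperbolicDSS

end

noncomputable section

namespace HyperbolicDSS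

/-! ### Weak derivatives in one variable -/

theorem exists_Ioo_of_isCompact_subset_Ioo {K : Set ℝ} {a b : ℝ} (hab : a < b) (hK : IsCompact K)
    (hKab : K ⊆ Ioo a b) : ∃ m M, a < m ∧ m < M ∧ M < b ∧ K ⊆ Ioo m M := by
  -- The midpoint is added so that extrema exist even when `K` is empty.
  have hc : IsCompact (insert ((a + b) / 2) K) := hK.insert _
  have hmem : (a + b) / 2 ∈ Ioo a b := ⟨by linarith, by linarith⟩
  have hsub : insert ((a + b) / 2) K ⊆ Ioo a b := insert_subset hmem hKab
  obtain ⟨p, hp, hpl⟩ := hc.exists_isLeast (insert_nonempty _ _)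
  obtain ⟨q, hq, hqu⟩ := hc.exists_isGreatest (insert_nonempty _ _)
  have h1 := hsub hp
  have h2 := hsub hq
  have h3 : p ≤ q := hqu hp
  refine ⟨(a + p) / 2, (q + b) / 2, by linarith [h1.1], by linarith [h1.1, h2.2],
    by linarith [h2.2], fun x hx => ?_⟩
  have h4 := hpl (mem_insert_of_mem _ hx)
  have h5 := hqu (mem_insert_of_mem _ hx)
  exact ⟨by linarith [h1.1], by linarith [h2.2]⟩

/-- A test function with zero integral is the derivative of a test function. -/
theorem exists_primitive_test {p : ℝ → ℝ} {a b : ℝ} (hab : a < b) (hp : ContDiff ℝ ∞ p)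
    (hpc : HasCompactSupport p) (hps : tsupport p ⊆ Ioo a b) (hp0 : ∫ x, p x = 0) :
    ∃ φ : ℝ → ℝ, ContDiff ℝ ∞ φ ∧ HasCompactSupport φ ∧ tsupport φ ⊆ Ioo a b ∧ deriv φ = p := by
  obtain ⟨m, M, ham, hmM, hMb, hK⟩ := exists_Ioo_of_isCompact_subset_Ioo hab hpc hps
  have hd : ∀ x, HasDerivAt (fun z => ∫ s in m..z, p s) (p x) x := fun x =>
    intervalIntegral.integral_hasDerivAt_right (hp.continuous.intervalIntegrable _ _)
      (hp.continuous.stronglyMeasurableAtFilter _ _) hp.continuous.continuousAt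
  have hderiv : deriv (fun z => ∫ s in m..z, p s) = p := funext fun x => (hd x).deriv
  have hzero : ∀ x, x ∉ Ioo m M → p x = 0 := fun x hx =>
    image_eq_zero_of_notMem_tsupport fun h => hx (hK h)
  have hsupp : Function.support (fun z => ∫ s in m..z, p s) ⊆ Icc m M := by
    intro z hz
    by_contra hzI
    apply hz
    rcases lt_or_ge z m with h | h
    · refine (intervalIntegral.integral_congr (g := fun _ => (0 : ℝ)) fun s hs => ?_).trans (by simp)
      rw [uIcc_of_ge h.le] at hs
      exact hzero s fun hs' => (hs'.1.trans_le hs.2).false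
    · have hz : M < z := by
        by_contra h'; exact hzI ⟨h, not_lt.1 h'⟩
      change ∫ s in m..z, p s = 0
      rw [intervalIntegral.integral_eq_integral_of_support_subset, hp0]
      intro s hs
      have : s ∈ Ioo m M := by
        by_contra h'; exact hs (hzero s h')
      exact ⟨this.1, (this.2.trans hz).le⟩
  have hts : tsupport (fun z => ∫ s in m..z, p s) ⊆ Icc m M :=
    closure_minimal hsupp isClosed_Icc
  refine ⟨fun z => ∫ s in m..z, p s, ?_, ?_, ?_, hderiv⟩
  · rw [contDiff_infty_iff_deriv, hderiv]
    exact ⟨fun x => (hd x).differentiableAt, hp⟩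
  · exact HasCompactSupport.of_support_subset_isCompact isCompact_Icc hsupp
  · exact hts.trans fun x hx => ⟨ham.trans_le hx.1, hx.2.trans_lt hMb⟩

theorem exists_test_integral_one {a b : ℝ} (hab : a < b) :
    ∃ χ : ℝ → ℝ, ContDiff ℝ ∞ χ ∧ HasCompactSupport χ ∧ tsupport χ ⊆ Ioo a b ∧ ∫ x, χ x = 1 := by
  let B : ContDiffBump ((a + b) / 2) :=
    { rIn := (b - a) / 8, rOut := (b - a) / 4, rIn_pos := by linarith, rIn_lt_rOut := by linarith }
  refine ⟨B.normed volume, B.contDiff_normed, B.hasCompactSupport_normed, ?_, B.integral_normed⟩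
  rw [B.tsupport_normed_eq, Real.closedBall_eq_Icc]
  intro x hx
  have h1 : (a + b) / 2 - (b - a) / 4 ≤ x := hx.1
  have h2 : x ≤ (a + b) / 2 + (b - a) / 4 := hx.2
  exact ⟨by linarith, by linarith⟩

theorem setIntegral_mul_of_tsupport_subset {φ u : ℝ → ℝ} {S : Set ℝ} (h : tsupport φ ⊆ S) :
    ∫ z in S, φ z * u z = ∫ z, φ z * u z :=
  setIntegral_eq_integral_of_forall_compl_eq_zero fun x hx => by
    rw [image_eq_zero_of_notMem_tsupport fun h' => hx (h h'), zero_mul]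

theorem tsupport_sub_subset (f g : ℝ → ℝ) :
    tsupport (fun z => f z - g z) ⊆ tsupport f ∪ tsupport g := by
  refine closure_minimal (fun x hx => ?_) ((isClosed_tsupport f).union (isClosed_tsupport g))
  by_contra h
  rw [mem_union, not_or] at h
  exact hx (by simp [image_eq_zero_of_notMem_tsupport h.1, image_eq_zero_of_notMem_tsupport h.2])

/-- The lemma of du Bois-Reymond. -/
theorem eq_const_of_integral_deriv_mul_eq_zero {u : ℝ → ℝ} {a b : ℝ} (hab : a < b)
    (hu : ContinuousOn u (Icc a b))
    (h : ∀ φ : ℝ → ℝ, ContDiff ℝ ∞ φ → HasCompactSupport φ → tsupport φ ⊆ Ioo a b →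
      ∫ z in Ioo a b, deriv φ z * u z = 0) : ∃ C, ∀ x ∈ Icc a b, u x = C := by
  obtain ⟨χ, hχ, hχc, hχs, hχ1⟩ := exists_test_integral_one hab
  have huo : IntegrableOn u (Ioo a b) :=
    (hu.integrableOn_compact isCompact_Icc).mono_set Ioo_subset_Icc_self
  have hint : ∀ ψ : ℝ → ℝ, Continuous ψ → IntegrableOn (fun z => ψ z * u z) (Ioo a b) :=
    fun ψ hψ => ((hψ.continuousOn.mul hu).integrableOn_compact isCompact_Icc).mono_set
      Ioo_subset_Icc_self
  set C := ∫ z in Ioo a b, χ z * u z with hC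
  have hae : ∀ᵐ x, x ∈ Ioo a b → u x - C = 0 := by
    refine isOpen_Ioo.ae_eq_zero_of_integral_contDiff_smul_eq_zero ?_ fun ψ hψ hψc hψs => ?_
    · exact ContinuousOn.locallyIntegrableOn
        ((hu.mono Ioo_subset_Icc_self).sub continuousOn_const) measurableSet_Ioo
    -- Subtracting `k` times the unit-mass bump `χ` leaves mean zero, so the result is the
    -- derivative of a test function.
    · set k := ∫ x, ψ x with hk
      have hp : ContDiff ℝ ∞ fun z => ψ z - k * χ z := hψ.sub (contDiff_const.mul hχ)
      have hps : tsupport (fun z => ψ z - k * χ z) ⊆ tsupport ψ ∪ tsupport χ :=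
        (tsupport_sub_subset _ _).trans (union_subset_union_right _ (tsupport_mul_subset_right))
      have hpc : HasCompactSupport fun z => ψ z - k * χ z :=
        IsCompact.of_isClosed_subset (hψc.isCompact.union hχc.isCompact) (isClosed_tsupport _) hps
      have hψi := hψ.continuous.integrable_of_hasCompactSupport (μ := volume) hψc
      have hχi := hχ.continuous.integrable_of_hasCompactSupport (μ := volume) hχc
      obtain ⟨φ, hφ, hφc, hφs, hφd⟩ := exists_primitive_test hab hp hpc
        (hps.trans (union_subset hψs hχs)) (by
          rw [integral_sub hψi (hχi.const_mul k), integral_const_mul, hχ1, ← hk]; ring)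
      have h0 := h φ hφ hφc hφs
      rw [hφd] at h0
      have e1 : ∫ z in Ioo a b, (ψ z - k * χ z) * u z
          = (∫ z in Ioo a b, ψ z * u z) - k * C := by
        rw [hC, ← integral_const_mul, ← integral_sub (hint ψ hψ.continuous)
          ((hint χ hχ.continuous).const_mul k)]
        congr 1; funext z; ring
      have e2 : ∫ x, ψ x • (u x - C) = (∫ z in Ioo a b, ψ z * u z) - k * C := by
        simp only [smul_eq_mul]
        rw [← setIntegral_mul_of_tsupport_subset hψs, hk,
          ← setIntegral_eq_integral_of_forall_compl_eq_zero (s := Ioo a b) (f := ψ)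
            (fun x hx => image_eq_zero_of_notMem_tsupport fun h' => hx (hψs h')),
          ← integral_mul_const, ← integral_sub (hint ψ hψ.continuous)
          (hψi.integrableOn.mul_const C)]
        congr 1; funext z; ring
      rw [e2, ← e1, h0]
  have hae' : u =ᵐ[volume.restrict (Ioo a b)] fun _ => C := by
    rw [Filter.EventuallyEq, ae_restrict_iff' measurableSet_Ioo]
    filter_upwards [hae] with x hx hxI
    exact sub_eq_zero.1 (hx hxI)
  have heq : EqOn u (fun _ => C) (Ioo a b) :=
    Measure.eqOn_open_of_ae_eq hae' isOpen_Ioo (hu.mono Ioo_subset_Icc_self) continuousOn_const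
  refine ⟨C, fun x hx => ?_⟩
  have hcl : EqOn u (fun _ => C) (Icc a b) :=
    heq.of_subset_closure hu continuousOn_const Ioo_subset_Icc_self (by rw [closure_Ioo hab.ne])
  exact hcl hx

/-- Integration by parts shows that `f` minus the primitive of `g` has weak derivative zero, hence
is constant by du Bois-Reymond. -/
theorem hasACDeriv_of_test {f g : ℝ → ℝ} {a b : ℝ} (hab : a < b) (hf : ContinuousOn f (Icc a b))
    (hg : IntegrableOn g (Ioo a b))
    (h : ∀ φ : ℝ → ℝ, ContDiff ℝ ∞ φ → HasCompactSupport φ → tsupport φ ⊆ Ioo a b →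
      ∫ z in Ioo a b, deriv φ z * f z = -∫ z in Ioo a b, φ z * g z) :
    HasACDeriv f g a b := by
  have hgi : IntervalIntegrable g volume a b := by
    rwa [intervalIntegrable_iff_integrableOn_Ioo_of_le hab.le]
  have hΓ : HasACDeriv (fun z => ∫ s in a..z, g s) g a b :=
    HasACDeriv.of_integral (c := 0) hab.le hgi fun x _ => by simp
  have hΓc := hΓ.continuousOn hab.le
  obtain ⟨C, hC⟩ := eq_const_of_integral_deriv_mul_eq_zero hab (hf.sub hΓc)
    fun φ hφ hφc hφs => by
      have hφd : HasACDeriv φ (deriv φ) a b :=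
        HasACDeriv.of_hasDerivAt (hφ.continuous_deriv (by simp)) fun x =>
          (hφ.differentiable (by simp) x).hasDerivAt
      have h1 := (hφd.mul hΓ).integral_eq_sub hab.le
      have hb : ∀ x, x ∉ Ioo a b → φ x = 0 := fun x hx =>
        image_eq_zero_of_notMem_tsupport fun h' => hx (hφs h')
      rw [hb b (by simp), hb a (by simp), zero_mul, zero_mul, sub_zero,
        intervalIntegral.integral_of_le hab.le, integral_Ioc_eq_integral_Ioo] at h1
      have hdc : Continuous (deriv φ) := hφ.continuous_deriv (by simp)
      have i1 : IntegrableOn (fun z => deriv φ z * f z) (Ioo a b) :=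
        ((hdc.continuousOn.mul hf).integrableOn_compact isCompact_Icc).mono_set
          Ioo_subset_Icc_self
      have i2 : IntegrableOn (fun z => deriv φ z * ∫ s in a..z, g s) (Ioo a b) :=
        ((hdc.continuousOn.mul hΓc).integrableOn_compact isCompact_Icc).mono_set
          Ioo_subset_Icc_self
      have i3 : IntegrableOn (fun z => φ z * g z) (Ioo a b) := by
        rw [← intervalIntegrable_iff_integrableOn_Ioo_of_le hab.le]
        exact hgi.continuousOn_mul hφ.continuous.continuousOn
      rw [integral_add i2 i3] at h1
      have h2 := h φ hφ hφc hφs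
      simp only [Pi.sub_apply, mul_sub]
      rw [integral_sub i1 i2]
      linarith
  refine HasACDeriv.of_integral (c := C) hab.le hgi fun x hx => ?_
  have := hC x hx
  simp only [Pi.sub_apply] at this
  linarith

/-! ### Vector-valued H¹ functions, componentwise. -/

variable {n : ℕ} {f g : ℝ → EuclideanSpace ℝ (Fin n)}

theorem setIntegral_euclidean_apply {F : ℝ → EuclideanSpace ℝ (Fin n)} {S : Set ℝ}
    (hF : IntegrableOn F S) (i : Fin n) : (∫ z in S, F z) i = ∫ z in S, F z i :=
  ((EuclideanSpace.proj (𝕜 := ℝ) i).integral_comp_comm hF).symm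

theorem continuousOn_coord {S : Set ℝ} (hf : ContinuousOn f S) (i : Fin n) :
    ContinuousOn (fun z => f z i) S :=
  (EuclideanSpace.proj (𝕜 := ℝ) i).continuous.comp_continuousOn hf

theorem memLp_coord {p : ℝ≥0∞} {m : Measure ℝ} (hf : MemLp f p m) (i : Fin n) :
    MemLp (fun z => f z i) p m :=
  (EuclideanSpace.proj (𝕜 := ℝ) i).comp_memLp' hf

theorem IsWeakDeriv.hasACDeriv (h : IsWeakDeriv f g) (hf : ContinuousOn f (Icc 0 1)) (i : Fin n) :
    HasACDeriv (fun z => f z i) (fun z => g z i) 0 1 := by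
  have hgi : IntegrableOn g (Ioo 0 1) := h.1.integrable (by norm_num)
  refine hasACDeriv_of_test one_pos (continuousOn_coord hf i)
    ((memLp_coord h.1 i).integrable (by norm_num)) fun φ hφ hφc hφs => ?_
  have h1 := congrArg (fun v : EuclideanSpace ℝ (Fin n) => v i) (h.2 φ hφ hφc hφs)
  have hdc : Continuous (deriv φ) := hφ.continuous_deriv (by simp)
  have i1 : IntegrableOn (fun z => deriv φ z • f z) (Ioo (0 : ℝ) 1) :=
    ((hdc.continuousOn.smul hf).integrableOn_compact isCompact_Icc).mono_set Ioo_subset_Icc_self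
  have i2 : IntegrableOn (fun z => φ z • g z) (Ioo (0 : ℝ) 1) := by
    obtain ⟨C, hC⟩ := hφc.exists_bound_of_continuous hφ.continuous
    exact hgi.bdd_smul C hφ.continuous.aestronglyMeasurable (ae_of_all _ hC)
  simp only [PiLp.neg_apply] at h1
  rw [setIntegral_euclidean_apply i1, setIntegral_euclidean_apply i2] at h1
  simpa using h1

theorem isWeakDeriv_weakDeriv (hf : MemH1 f) : IsWeakDeriv f (weakDeriv f) := by
  unfold weakDeriv
  rw [dif_pos hf.2]
  exact hf.2.choose_spec

theorem MemH1.hasACDeriv (hf : MemH1 f) (i : Fin n) :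
    HasACDeriv (fun z => f z i) (fun z => weakDeriv f z i) 0 1 :=
  (isWeakDeriv_weakDeriv hf).hasACDeriv hf.1 i

theorem MemH1.sub (hf : MemH1 f) (hg : MemH1 g) : MemH1 fun z => f z - g z := by
  refine ⟨hf.1.sub hg.1, fun z => weakDeriv f z - weakDeriv g z, ?_, fun φ hφ hφc hφs => ?_⟩
  · exact (isWeakDeriv_weakDeriv hf).1.sub (isWeakDeriv_weakDeriv hg).1
  have hdc : Continuous (deriv φ) := hφ.continuous_deriv (by simp)
  have i1 : ∀ {f : ℝ → EuclideanSpace ℝ (Fin n)}, ContinuousOn f (Icc 0 1) →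
      IntegrableOn (fun z => deriv φ z • f z) (Ioo (0 : ℝ) 1) := fun hf =>
    ((hdc.continuousOn.smul hf).integrableOn_compact isCompact_Icc).mono_set Ioo_subset_Icc_self
  have i2 : ∀ {g : ℝ → EuclideanSpace ℝ (Fin n)}, MemLp g 2 (volume.restrict (Ioo 0 1)) →
      IntegrableOn (fun z => φ z • g z) (Ioo (0 : ℝ) 1) := fun hg => by
    obtain ⟨C, hC⟩ := hφc.exists_bound_of_continuous hφ.continuous
    exact (hg.integrable (by norm_num)).bdd_smul C hφ.continuous.aestronglyMeasurable
      (ae_of_all _ hC)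
  have h1 := (isWeakDeriv_weakDeriv hf).2 φ hφ hφc hφs
  have h2 := (isWeakDeriv_weakDeriv hg).2 φ hφ hφc hφs
  simp only [smul_sub]
  rw [integral_sub (i1 hf.1) (i1 hg.1), h1, h2,
    integral_sub (i2 (isWeakDeriv_weakDeriv hf).1) (i2 (isWeakDeriv_weakDeriv hg).1)]
  abel

theorem IsWeakDeriv.congr (h : IsWeakDeriv f g) {f₂ : ℝ → EuclideanSpace ℝ (Fin n)}
    (hff : EqOn f f₂ (Ioo 0 1)) : IsWeakDeriv f₂ g := by
  refine ⟨h.1, fun φ hφ hφc hφs => ?_⟩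
  rw [← h.2 φ hφ hφc hφs]
  exact setIntegral_congr_fun measurableSet_Ioo fun z hz => by simp only [hff hz]

theorem MemH1.congr (h : MemH1 f) (hfg : EqOn f g (Icc 0 1)) : MemH1 g :=
  ⟨h.1.congr fun _ hz => (hfg hz).symm,
    h.2.imp fun _ hd => hd.congr (hfg.mono Ioo_subset_Icc_self)⟩

theorem MemH1.intervalIntegrable_weakDeriv_sq (hf : MemH1 f) (i : Fin n) :
    IntervalIntegrable (fun z => weakDeriv f z i ^ 2) volume 0 1 := by
  rw [intervalIntegrable_iff_integrableOn_Ioo_of_le zero_le_one]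
  exact (memLp_coord (isWeakDeriv_weakDeriv hf).1 i).integrable_sq

theorem MemH1.intervalIntegrable_sq (hf : MemH1 f) (i : Fin n) :
    IntervalIntegrable (fun z => f z i ^ 2) volume 0 1 := by
  apply ContinuousOn.intervalIntegrable
  rw [uIcc_of_le zero_le_one]
  exact (continuousOn_coord hf.1 i).pow 2

theorem MemH1.h1NormSq_eq (hf : MemH1 f) :
    h1NormSq f = ∑ i, ((∫ z in (0 : ℝ)..1, f z i ^ 2)
      + ∫ z in (0 : ℝ)..1, weakDeriv f z i ^ 2) := by
  have key : ∀ F : ℝ → EuclideanSpace ℝ (Fin n),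
      (∀ i, IntervalIntegrable (fun z => F z i ^ 2) volume 0 1) →
      ∫ z in Ioo (0 : ℝ) 1, ‖F z‖ ^ 2 = ∑ i, ∫ z in (0 : ℝ)..1, F z i ^ 2 := by
    intro F hF
    rw [← intervalIntegral.integral_finsetSum fun i _ => hF i,
      intervalIntegral.integral_of_le zero_le_one, integral_Ioc_eq_integral_Ioo]
    simp only [EuclideanSpace.real_norm_sq_eq]
  unfold h1NormSq
  rw [key f hf.intervalIntegrable_sq, key _ hf.intervalIntegrable_weakDeriv_sq,
    Finset.sum_add_distrib]

/-- The Sobolev embedding of `H¹(0,1)` into the continuous functions. -/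
theorem MemH1.norm_sq_le (hf : MemH1 f) {z : ℝ} (hz : z ∈ Icc (0 : ℝ) 1) :
    ‖f z‖ ^ 2 ≤ 2 * h1NormSq f := by
  rw [hf.h1NormSq_eq, EuclideanSpace.real_norm_sq_eq, Finset.mul_sum]
  refine Finset.sum_le_sum fun i _ => ?_
  have := (hf.hasACDeriv i).sq_le one_pos (hf.intervalIntegrable_weakDeriv_sq i) hz
  linarith

end HyperbolicDSS

end

noncomputable section

namespace HyperbolicDSS

/-! ### Weak solutions are constant along characteristics -/

section Transport

variable {Y : ℝ × ℝ → ℝ} {l : ℝ}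

/-- `Y_t + l Y_z = 0` in the sense of distributions on `(0, ∞) × (0, 1)`. -/
def IsTransported (l : ℝ) (Y : ℝ × ℝ → ℝ) : Prop :=
  ∀ φ : ℝ → ℝ → ℝ, ContDiff ℝ ∞ (Function.uncurry φ) → HasCompactSupport (Function.uncurry φ) →
    tsupport (Function.uncurry φ) ⊆ Ioi 0 ×ˢ Ioo 0 1 →
    ∫ p : ℝ × ℝ, (deriv (fun s => φ s p.2) p.1 + l * deriv (fun x => φ p.1 x) p.2) * Y p = 0

/-- Test with `a (t - z / l) * b z`: the transport operator annihilates the first factor and leaves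
`l * a * b'`. Fubini and the shift `t = s + z / l` give the formula. -/
theorem IsTransported.integral_eq_zero (hl : 0 < l) (hY : Continuous Y) (H : IsTransported l Y)
    {a b : ℝ → ℝ} (ha : ContDiff ℝ ∞ a) (hac : HasCompactSupport a)
    (hb : ContDiff ℝ ∞ b) (hbc : HasCompactSupport b)
    (hsupp : ∀ s ∈ tsupport a, ∀ z ∈ tsupport b, 0 < s + z / l ∧ z ∈ Ioo (0 : ℝ) 1) :
    ∫ z, deriv b z * ∫ s, a s * Y (s + z / l, z) = 0 := by
  set φ : ℝ → ℝ → ℝ := fun t z => a (t - z / l) * b z with hφ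
  have hφd : ContDiff ℝ ∞ (Function.uncurry φ) := by
    have : ContDiff ℝ ∞ fun p : ℝ × ℝ => a (p.1 - p.2 / l) * b p.2 := by fun_prop
    exact this
  set K : Set (ℝ × ℝ) := (fun p : ℝ × ℝ => (p.1 + p.2 / l, p.2)) '' (tsupport a ×ˢ tsupport b)
    with hK
  have hKc : IsCompact K := (hac.isCompact.prod hbc.isCompact).image (by fun_prop)
  have hsK : ∀ p : ℝ × ℝ, p.1 - p.2 / l ∈ tsupport a → p.2 ∈ tsupport b → p ∈ K := by
    intro p h1 h2
    exact ⟨(p.1 - p.2 / l, p.2), ⟨h1, h2⟩, by simp⟩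
  have hφK : Function.support (Function.uncurry φ) ⊆ K := by
    intro p hp
    have hp' : a (p.1 - p.2 / l) * b p.2 ≠ 0 := hp
    exact hsK p (subset_tsupport _ (left_ne_zero_of_mul hp'))
      (subset_tsupport _ (right_ne_zero_of_mul hp'))
  have hφt : tsupport (Function.uncurry φ) ⊆ K := closure_minimal hφK hKc.isClosed
  have h0 := H φ hφd (HasCompactSupport.of_support_subset_isCompact hKc hφK) (hφt.trans (by
    rintro _ ⟨p, ⟨hp1, hp2⟩, rfl⟩
    obtain ⟨h1, h2⟩ := hsupp p.1 hp1 p.2 hp2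
    exact ⟨h1, h2⟩))
  have hda : ∀ x, HasDerivAt a (deriv a x) x := fun x =>
    (ha.differentiable (by simp) x).hasDerivAt
  have hdb : ∀ x, HasDerivAt b (deriv b x) x := fun x =>
    (hb.differentiable (by simp) x).hasDerivAt
  have hpt : ∀ p : ℝ × ℝ,
      (deriv (fun s => φ s p.2) p.1 + l * deriv (fun x => φ p.1 x) p.2) * Y p
        = l * (a (p.1 - p.2 / l) * deriv b p.2 * Y p) := by
    rintro ⟨t, z⟩
    have e1 : HasDerivAt (fun s => φ s z) (deriv a (t - z / l) * b z) t := by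
      have := ((hda (t - z / l)).comp t ((hasDerivAt_id' t).sub_const (z / l))).mul_const (b z)
      simpa using this
    have e2 : HasDerivAt (fun x => φ t x)
        (deriv a (t - z / l) * (-(1 / l)) * b z + a (t - z / l) * deriv b z) z := by
      have := ((hda (t - z / l)).comp z (((hasDerivAt_id' z).div_const l).const_sub t)).mul (hdb z)
      exact this
    simp only [e1.deriv, e2.deriv]
    field_simp
    ring
  have hbd : Continuous (deriv b) := hb.continuous_deriv (by simp)
  simp only [hpt] at h0
  rw [integral_const_mul, mul_eq_zero, or_iff_right hl.ne'] at h0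
  have hcont : Continuous fun p : ℝ × ℝ => a (p.1 - p.2 / l) * deriv b p.2 * Y p := by
    have := ha.continuous
    fun_prop
  have hint : Integrable fun p : ℝ × ℝ => a (p.1 - p.2 / l) * deriv b p.2 * Y p := by
    refine hcont.integrable_of_hasCompactSupport
      (HasCompactSupport.of_support_subset_isCompact hKc fun p hp => ?_)
    have hp' : a (p.1 - p.2 / l) * deriv b p.2 * Y p ≠ 0 := hp
    have h1 := left_ne_zero_of_mul hp'
    exact hsK p (subset_tsupport _ (left_ne_zero_of_mul h1))
      (support_deriv_subset (right_ne_zero_of_mul h1))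
  rw [Measure.volume_eq_prod, integral_prod_symm _ hint] at h0
  rw [← h0]
  refine integral_congr_ae (ae_of_all _ fun z => ?_)
  dsimp only
  rw [← integral_const_mul, ← integral_sub_right_eq_self (μ := volume) _ (z / l)]
  refine integral_congr_ae (ae_of_all _ fun t => ?_)
  simp only [sub_add_cancel]
  ring

/-- For fixed `a`, the average `∫ a s * Y (s + z / l, z)` does not depend on `z`, by du
Bois-Reymond. As `a` is arbitrary and `Y` continuous, equality holds for each `s`. -/
theorem IsTransported.eq_of_lt (hl : 0 < l) (hY : Continuous Y) (H : IsTransported l Y)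
    {z₀ z₁ : ℝ} (h0 : 0 < z₀) (h01 : z₀ < z₁) (h1 : z₁ < 1) {s : ℝ} (hs : 0 < s + z₀ / l) :
    Y (s + z₁ / l, z₁) = Y (s + z₀ / l, z₀) := by
  have key : ∀ a : ℝ → ℝ, ContDiff ℝ ∞ a → HasCompactSupport a → tsupport a ⊆ Ioi (-(z₀ / l)) →
      ∫ s, a s • (Y (s + z₁ / l, z₁) - Y (s + z₀ / l, z₀)) = 0 := by
    intro a ha hac has
    have hcont : Continuous (Function.uncurry fun z s : ℝ => a s * Y (s + z / l, z)) := by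
      have := ha.continuous
      simp only [Function.uncurry_def]
      fun_prop
    have hcz : Continuous fun z : ℝ => ∫ s, a s * Y (s + z / l, z) := by
      have := continuous_parametric_integral_of_continuous (μ := (volume : Measure ℝ)) hcont
        hac.isCompact
      convert! this using 2 with z
      refine (setIntegral_eq_integral_of_forall_compl_eq_zero fun x hx => ?_).symm
      rw [image_eq_zero_of_notMem_tsupport hx, zero_mul]
    obtain ⟨C, hC⟩ := eq_const_of_integral_deriv_mul_eq_zero h01 hcz.continuousOn
      fun b hb hbc hbs => by
        rw [setIntegral_mul_of_tsupport_subset ((tsupport_deriv_subset).trans hbs)]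
        refine H.integral_eq_zero hl hY ha hac hb hbc fun s hs z hz => ⟨?_, ?_⟩
        · have h2 := has hs
          have h3 : z₀ / l < z / l := by
            have := (hbs hz).1
            gcongr
          rw [mem_Ioi] at h2
          linarith
        · exact ⟨h0.trans (hbs hz).1, (hbs hz).2.trans h1⟩
    have hi : ∀ z : ℝ, Integrable fun s => a s * Y (s + z / l, z) := fun z => by
      refine Continuous.integrable_of_hasCompactSupport ?_ hac.mul_right
      have := ha.continuous
      fun_prop
    simp only [smul_eq_mul, mul_sub]
    rw [integral_sub (hi z₁) (hi z₀), hC z₁ (right_mem_Icc.2 h01.le), hC z₀ (left_mem_Icc.2 h01.le),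
      sub_self]
  have hc : Continuous fun s => Y (s + z₁ / l, z₁) - Y (s + z₀ / l, z₀) := by fun_prop
  have hae := isOpen_Ioi.ae_eq_zero_of_integral_contDiff_smul_eq_zero
    (hc.locallyIntegrable.locallyIntegrableOn _) key
  have hae' : (fun s => Y (s + z₁ / l, z₁) - Y (s + z₀ / l, z₀))
      =ᵐ[volume.restrict (Ioi (-(z₀ / l)))] fun _ => 0 := by
    rwa [Filter.EventuallyEq, ae_restrict_iff' measurableSet_Ioi]
  exact sub_eq_zero.1 (Measure.eqOn_open_of_ae_eq hae' isOpen_Ioi hc.continuousOn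
    continuousOn_const (by rw [mem_Ioi]; linarith))

theorem IsTransported.eq (hl : 0 < l) (hY : Continuous Y) (H : IsTransported l Y)
    {z z' s : ℝ} (hz : z ∈ Icc (0 : ℝ) 1) (hz' : z' ∈ Icc (0 : ℝ) 1)
    (hs : 0 ≤ s + z / l) (hs' : 0 ≤ s + z' / l) :
    Y (s + z / l, z) = Y (s + z' / l, z') := by
  -- The position where this characteristic enters the closed domain, through `z = 0` or through `t
  -- = 0`. Equality on the open segment `(c, 1)` extends to its ends by continuity.
  set c := max 0 (-(s * l)) with hc
  have hmem : ∀ x ∈ Icc (0 : ℝ) 1, 0 ≤ s + x / l → x ∈ Icc c 1 := fun x hx h => by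
    refine ⟨max_le hx.1 ?_, hx.2⟩
    have h2 : -s ≤ x / l := by linarith
    rw [le_div_iff₀ hl] at h2
    linarith
  have hzc := hmem z hz hs
  have hzc' := hmem z' hz' hs'
  rcases (hzc.1.trans hzc.2).eq_or_lt with h | h
  · have : z = z' := by linarith [hzc.1, hzc.2, hzc'.1, hzc'.2]
    rw [this]
  have hpos : ∀ x, c < x → 0 < s + x / l := fun x hx => by
    have h1 : -(s * l) < x := (le_max_right _ _).trans_lt hx
    have : -s < x / l := by rw [lt_div_iff₀ hl]; linarith
    linarith
  have h0 : 0 ≤ c := le_max_left _ _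
  set m := (c + 1) / 2 with hm
  have heq : EqOn (fun x => Y (s + x / l, x)) (fun _ => Y (s + m / l, m)) (Ioo c 1) := by
    intro x hx
    rcases lt_trichotomy x m with hxm | rfl | hxm
    · exact (H.eq_of_lt hl hY (h0.trans_lt hx.1) hxm (by linarith) (hpos x hx.1)).symm
    · rfl
    · exact H.eq_of_lt hl hY (by linarith) hxm hx.2 (hpos m (by linarith))
  have hcl : EqOn (fun x => Y (s + x / l, x)) (fun _ => Y (s + m / l, m)) (Icc c 1) :=
    heq.of_subset_closure (by fun_prop) continuousOn_const Ioo_subset_Icc_self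
      (by rw [closure_Ioo h.ne])
  exact (hcl hzc).trans (hcl hzc').symm

end Transport

/-! ### Joint continuity of solutions and regularity of their traces. -/

section Solution

variable {n m : ℕ} {Λ H : Matrix (Fin n) (Fin n) ℝ} {B : Matrix (Fin n) (Fin m) ℝ}
  {K : Matrix (Fin m) (Fin n) ℝ} {α : ℝ} {d : ℝ → EuclideanSpace ℝ (Fin n)}
  {X₀ : ℝ → EuclideanSpace ℝ (Fin n)} {η₀ : EuclideanSpace ℝ (Fin n)}
  {X : ℝ → ℝ → EuclideanSpace ℝ (Fin n)} {η : ℝ → EuclideanSpace ℝ (Fin n)}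

/-- By the Sobolev embedding, continuity in time for the H¹ norm is uniform in `z`; it combines with
continuity in `z` at a fixed time. -/
theorem IsSolution.continuousOn_uncurry (hX : IsSolution Λ H B K α d X₀ η₀ X η) :
    ContinuousOn (Function.uncurry X) (Ici 0 ×ˢ Icc 0 1) := by
  rintro ⟨s, z⟩ ⟨hs, hz⟩
  rw [ContinuousWithinAt, tendsto_iff_norm_sub_tendsto_zero]
  have h1 : Tendsto (fun p : ℝ × ℝ => √(2 * h1NormSq fun z => X p.1 z - X s z))
      (𝓝[Ici 0 ×ˢ Icc 0 1] (s, z)) (𝓝 0) := by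
    have h := (((hX.continuous_h1 s hs).const_mul 2).sqrt)
    rw [mul_zero, Real.sqrt_zero] at h
    refine h.comp (tendsto_nhdsWithin_iff.2 ⟨?_, ?_⟩)
    · exact (continuous_fst.tendsto (s, z)).mono_left nhdsWithin_le_nhds
    · filter_upwards [self_mem_nhdsWithin] with p hp using hp.1
  have h2 : Tendsto (fun p : ℝ × ℝ => ‖X s p.2 - X s z‖)
      (𝓝[Ici 0 ×ˢ Icc 0 1] (s, z)) (𝓝 0) := by
    rw [← tendsto_iff_norm_sub_tendsto_zero]
    refine ((hX.memH1 s hs).1 z hz).tendsto.comp (tendsto_nhdsWithin_iff.2 ⟨?_, ?_⟩)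
    · exact (continuous_snd.tendsto (s, z)).mono_left nhdsWithin_le_nhds
    · filter_upwards [self_mem_nhdsWithin] with p hp using hp.2
  have h3 := h1.add h2
  rw [add_zero] at h3
  refine squeeze_zero' (Eventually.of_forall fun _ => norm_nonneg _) ?_ h3
  filter_upwards [self_mem_nhdsWithin] with p hp
  have h4 := ((hX.memH1 p.1 hp.1).sub (hX.memH1 s hs)).norm_sq_le hp.2
  have h5 := Real.le_sqrt_of_sq_le h4
  have h6 : Function.uncurry X p - Function.uncurry X (s, z)
      = (X p.1 p.2 - X s p.2) + (X s p.2 - X s z) := by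
    simp [Function.uncurry]
  rw [h6]
  exact (norm_add_le _ _).trans (add_le_add_left h5 _)

theorem toEuclideanLin_apply_of_isDiag (hΛ : Λ.IsDiag) (v : EuclideanSpace ℝ (Fin n)) (i : Fin n) :
    Matrix.toEuclideanLin Λ v i = Λ i i * v i := by
  change (Λ *ᵥ v.ofLp) i = _
  rw [← hΛ.diagonal_diag, Matrix.mulVec_diagonal]
  simp

/-- The solution extended to `ℝ × ℝ` by projecting onto `[0, ∞) × [0, 1]`. -/
def extendSolution (X : ℝ → ℝ → EuclideanSpace ℝ (Fin n)) (p : ℝ × ℝ) :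
    EuclideanSpace ℝ (Fin n) :=
  X (max p.1 0) (max 0 (min p.2 1))

theorem extendSolution_eq {t z : ℝ} (ht : 0 ≤ t) (hz : z ∈ Icc (0 : ℝ) 1) :
    extendSolution X (t, z) = X t z := by
  simp [extendSolution, max_eq_left ht, min_eq_left hz.2, max_eq_right hz.1]

theorem IsSolution.continuous_extend (hX : IsSolution Λ H B K α d X₀ η₀ X η) :
    Continuous (extendSolution X) := by
  have : Continuous fun p : ℝ × ℝ => (max p.1 0, max 0 (min p.2 1)) := by fun_prop
  exact hX.continuousOn_uncurry.comp_continuous this fun p =>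
    ⟨mem_Ici.2 (le_max_right _ _), le_max_left _ _, max_le zero_le_one (min_le_right _ _)⟩

/-- A diagonal `Λ` decouples the components. The test function is supported in the open domain, so
extending the solution does not change the integral. -/
theorem IsSolution.isTransported (hX : IsSolution Λ H B K α d X₀ η₀ X η) (hΛ : Λ.IsDiag)
    (i : Fin n) : IsTransported (Λ i i) fun p => extendSolution X p i := by
  intro φ hφ hφc hφs
  set dt : ℝ × ℝ → ℝ := fun p => deriv (fun s => φ s p.2) p.1 with hdt
  set dz : ℝ × ℝ → ℝ := fun p => deriv (fun x => φ p.1 x) p.2 with hdz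
  have hdiff : Differentiable ℝ (Function.uncurry φ) := hφ.differentiable (by simp)
  have hdt' : dt = fun p => fderiv ℝ (Function.uncurry φ) p (1, 0) := by
    funext p
    have h1 : HasDerivAt (fun s : ℝ => (s, p.2)) (1, 0) p.1 :=
      (hasDerivAt_id' p.1).prodMk (hasDerivAt_const _ _)
    exact ((hdiff p).hasFDerivAt.comp_hasDerivAt p.1 h1).deriv
  have hdz' : dz = fun p => fderiv ℝ (Function.uncurry φ) p (0, 1) := by
    funext p
    have h1 : HasDerivAt (fun s : ℝ => (p.1, s)) (0, 1) p.2 :=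
      (hasDerivAt_const _ _).prodMk (hasDerivAt_id' p.2)
    exact ((hdiff p).hasFDerivAt.comp_hasDerivAt p.2 h1).deriv
  have hfc : Continuous (fderiv ℝ (Function.uncurry φ)) := hφ.continuous_fderiv (by simp)
  have hdtc : Continuous dt := by rw [hdt']; fun_prop
  have hdzc : Continuous dz := by rw [hdz']; fun_prop
  have hz : ∀ p, p ∉ tsupport (Function.uncurry φ) → dt p = 0 ∧ dz p = 0 := by
    intro p hp
    have : fderiv ℝ (Function.uncurry φ) p = 0 := by
      by_contra h
      exact hp (support_fderiv_subset ℝ h)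
    rw [hdt', hdz']
    simp [this]
  set F : ℝ × ℝ → EuclideanSpace ℝ (Fin n) := fun p =>
    dt p • extendSolution X p + dz p • Matrix.toEuclideanLin Λ (extendSolution X p) with hF
  have hXc := hX.continuous_extend
  have hFc : Continuous F := by
    have h1 : Continuous (Matrix.toEuclideanLin Λ) := LinearMap.continuous_of_finiteDimensional _
    exact (hdtc.smul hXc).add (hdzc.smul (h1.comp hXc))
  have hF0 : ∀ p, p ∉ tsupport (Function.uncurry φ) → F p = 0 := fun p hp => by
    simp [hF, hz p hp]
  have hFi : Integrable F := hFc.integrable_of_hasCompactSupport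
    (HasCompactSupport.intro hφc.isCompact hF0)
  have hint : ∫ p, F p = 0 := by
    rw [← hX.pde φ hφ hφc hφs, Measure.volume_eq_prod,
      integral_prod _ (by rwa [← Measure.volume_eq_prod])]
    symm
    rw [← setIntegral_eq_integral_of_forall_compl_eq_zero (s := Ioi 0) (f := fun t => ∫ z, F (t, z))
      fun t ht => ?_]
    · refine setIntegral_congr_fun measurableSet_Ioi fun t ht => ?_
      rw [← setIntegral_eq_integral_of_forall_compl_eq_zero (s := Ioo 0 1) (f := fun z => F (t, z))
        fun z hz => hF0 _ fun h => hz (hφs h).2]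
      refine setIntegral_congr_fun measurableSet_Ioo fun z hz => ?_
      simp only [hF, hdt, hdz]
      rw [extendSolution_eq (le_of_lt ht) (Ioo_subset_Icc_self hz)]
    · have : ∀ z, F (t, z) = 0 := fun z => hF0 _ fun h => ht (hφs h).1
      simp [this]
  have hi := ((EuclideanSpace.proj (𝕜 := ℝ) i).integral_comp_comm hFi)
  rw [hint, map_zero] at hi
  rw [← hi]
  refine integral_congr_ae (ae_of_all _ fun p => ?_)
  simp only [hF, EuclideanSpace.coe_proj, PiLp.add_apply, PiLp.smul_apply, smul_eq_mul,
    toEuclideanLin_apply_of_isDiag hΛ]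
  ring

/-- The `i`-th component of the solution along the characteristics of speed `l`, as a function of
the time at which the characteristic leaves `z = 0`. -/
def trace (X : ℝ → ℝ → EuclideanSpace ℝ (Fin n)) (l : ℝ) (i : Fin n) (s : ℝ) : ℝ :=
  if 0 ≤ s then X s 0 i else X 0 (-(l * s)) i

theorem IsSolution.apply_eq_trace (hX : IsSolution Λ H B K α d X₀ η₀ X η) (hΛ : Λ.IsDiag)
    (i : Fin n) (hl : 0 < Λ i i) {t z : ℝ} (ht : 0 ≤ t) (hz : z ∈ Icc (0 : ℝ) 1) :
    X t z i = trace X (Λ i i) i (t - z / Λ i i) := by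
  have hY : Continuous fun p => extendSolution X p i :=
    (EuclideanSpace.proj (𝕜 := ℝ) i).continuous.comp hX.continuous_extend
  have H := hX.isTransported hΛ i
  set l := Λ i i
  unfold trace
  have hst : t - z / l + z / l = t := by ring
  split_ifs with h
  · have := H.eq hl hY (s := t - z / l) hz (left_mem_Icc.2 zero_le_one) (by rwa [hst]) (by simpa using h)
    rw [hst, zero_div, add_zero, extendSolution_eq ht hz,
      extendSolution_eq h (left_mem_Icc.2 zero_le_one)] at this
    exact this
  -- The characteristic starts on `t = 0`, at `z = -l * s` with `s < 0` its formal departure time.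
  · push Not at h
    have hz' : -(l * (t - z / l)) ∈ Icc (0 : ℝ) 1 := by
      constructor
      · nlinarith
      · have : l * (t - z / l) = l * t - z := by field_simp
        rw [this]
        nlinarith [hz.2]
    have h0 : t - z / l + -(l * (t - z / l)) / l = 0 := by field_simp; ring
    have := H.eq hl hY (s := t - z / l) hz hz' (by rwa [hst]) h0.ge
    rw [hst, h0, extendSolution_eq ht hz, extendSolution_eq le_rfl hz'] at this
    exact this

/-- The characteristics that meet `[0, 1]` at time `t` have departure times exactly `[t - 1/l, t]`,
so the trace there is the rescaled profile `X t`. The factor is `l ^ 2` from the chain rule divided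
by `l` from the change of variables. -/
theorem IsSolution.trace_window (hX : IsSolution Λ H B K α d X₀ η₀ X η) (hΛ : Λ.IsDiag)
    (i : Fin n) (hl : 0 < Λ i i) {t : ℝ} (ht : 0 ≤ t) :
    HasACDeriv (trace X (Λ i i) i) (deriv (trace X (Λ i i) i)) (t - 1 / Λ i i) t ∧
      IntervalIntegrable (fun s => deriv (trace X (Λ i i) i) s ^ 2) volume (t - 1 / Λ i i) t ∧
      ∫ s in (t - 1 / Λ i i)..t, deriv (trace X (Λ i i) i) s ^ 2
        = Λ i i * ∫ z in (0 : ℝ)..1, weakDeriv (X t) z i ^ 2 := by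
  have htr := fun {z} => hX.apply_eq_trace hΛ i hl ht (z := z)
  set l := Λ i i with hl_def
  have hmem := hX.memH1 t ht
  have h1 := (hmem.hasACDeriv i).comp_affine zero_le_one hl t
  rw [zero_div, sub_zero] at h1
  have hle : t - 1 / l ≤ t := by
    have : 0 < 1 / l := by positivity
    linarith
  have h2 : HasACDeriv (trace X l i) (fun s => -l * weakDeriv (X t) (l * (t - s)) i)
      (t - 1 / l) t := by
    refine h1.congr hle fun s hs => ?_
    have hz : l * (t - s) ∈ Icc (0 : ℝ) 1 := by
      refine ⟨mul_nonneg hl.le (by linarith [hs.2]), ?_⟩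
      have h3 : t - s ≤ 1 / l := by linarith [hs.1]
      rw [le_div_iff₀ hl] at h3
      linarith
    have := htr hz
    rw [mul_div_cancel_left₀ _ hl.ne'] at this
    simpa using this
  have hae := HasACDeriv.ae_uIoc_of_ae_Ioo hle h2.deriv_ae_eq
  have hint : IntervalIntegrable (fun s => (-l * weakDeriv (X t) (l * (t - s)) i) ^ 2) volume
      (t - 1 / l) t := by
    have h3 := ((hmem.intervalIntegrable_weakDeriv_sq i).comp_mul_left (c := l)).comp_sub_left t
    rw [zero_div, sub_zero] at h3
    simpa only [mul_pow] using h3.symm.const_mul ((-l) ^ 2)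
  refine ⟨h2.congr_deriv ?_, ?_, ?_⟩
  · filter_upwards [h2.deriv_ae_eq] with x hx hxI using (hx hxI).symm
  · refine hint.congr_ae ?_
    rw [Filter.EventuallyEq, ae_restrict_iff' measurableSet_uIoc]
    filter_upwards [hae] with x hx hxI
    rw [hx hxI]
  · rw [intervalIntegral.integral_congr_ae
      (g := fun s => l ^ 2 * weakDeriv (X t) (l * (t - s)) i ^ 2) (by
        filter_upwards [hae] with x hx hxI
        rw [hx hxI]; ring), intervalIntegral.integral_const_mul,
      intervalIntegral.integral_comp_sub_left (fun s => weakDeriv (X t) (l * s) i ^ 2) t,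
      intervalIntegral.integral_comp_mul_left (fun s => weakDeriv (X t) s i ^ 2) hl.ne']
    rw [sub_self, sub_sub_cancel, mul_zero, mul_one_div_cancel hl.ne', smul_eq_mul]
    field_simp

theorem IsSolution.integral_trace_sq (hX : IsSolution Λ H B K α d X₀ η₀ X η) (hΛ : Λ.IsDiag)
    (i : Fin n) (hl : 0 < Λ i i) {t : ℝ} (ht : 0 ≤ t) :
    Λ i i * ∫ s in (t - 1 / Λ i i)..t, trace X (Λ i i) i s ^ 2
      = ∫ z in (0 : ℝ)..1, X t z i ^ 2 := by
  have htr := fun {z} => hX.apply_eq_trace hΛ i hl ht (z := z)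
  set l := Λ i i with hl_def
  have : ∫ z in (0 : ℝ)..1, X t z i ^ 2 = ∫ z in (0 : ℝ)..1, trace X l i (t - z / l) ^ 2 := by
    refine intervalIntegral.integral_congr fun z hz => ?_
    rw [uIcc_of_le zero_le_one] at hz
    simp only [htr hz]
  rw [this, intervalIntegral.integral_comp_sub_div (fun s => trace X l i s ^ 2) hl.ne',
    smul_eq_mul, zero_div, sub_zero]

/-- Adjacent windows of length `1/l` are glued until they cover the interval. -/
theorem IsSolution.trace_hasACDeriv (hX : IsSolution Λ H B K α d X₀ η₀ X η) (hΛ : Λ.IsDiag)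
    (i : Fin n) (hl : 0 < Λ i i) {T : ℝ} (hT : 0 ≤ T) :
    HasACDeriv (trace X (Λ i i) i) (deriv (trace X (Λ i i) i)) (-(1 / Λ i i)) T ∧
      IntervalIntegrable (fun s => deriv (trace X (Λ i i) i) s ^ 2) volume (-(1 / Λ i i)) T := by
  have hw := fun {t} => hX.trace_window hΛ i hl (t := t)
  set l := Λ i i with hl_def
  have hτ : 0 < 1 / l := by positivity
  have key : ∀ k : ℕ,
      HasACDeriv (trace X l i) (deriv (trace X l i)) (-(1 / l)) (k * (1 / l)) ∧
      IntervalIntegrable (fun s => deriv (trace X l i) s ^ 2) volume (-(1 / l)) (k * (1 / l)) := by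
    intro k
    induction k with
    | zero => simpa only [Nat.cast_zero, zero_mul, zero_sub] using
        And.intro (hw le_rfl).1 (hw le_rfl).2.1
    | succ k ih =>
      have hk : (0 : ℝ) ≤ k * (1 / l) := by positivity
      have h2 := hw (t := (k + 1 : ℕ) * (1 / l)) (by positivity)
      have e : ((k + 1 : ℕ) : ℝ) * (1 / l) - 1 / l = k * (1 / l) := by push_cast; ring
      rw [e] at h2
      exact ⟨ih.1.glue h2.1 (by linarith) (by push_cast; linarith), ih.2.trans h2.2.1⟩
  obtain ⟨k, hk⟩ := exists_nat_ge (T / (1 / l))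
  rw [div_le_iff₀ hτ] at hk
  refine ⟨(key k).1.mono le_rfl (by linarith) hk, (key k).2.mono_set ?_⟩
  rw [uIcc_of_le (by linarith), uIcc_of_le (by linarith)]
  exact Icc_subset_Icc le_rfl hk

end Solution

end HyperbolicDSS

end

noncomputable section

namespace HyperbolicDSS

/-! ### The dissipation inequality encoded by `Ω` -/

section Dissipation

open Matrix

variable {n m : ℕ}

theorem dotProduct_self_eq_norm_sq (v : Fin n → ℝ) : v ⬝ᵥ v = ‖WithLp.toLp 2 v‖ ^ 2 := by
  rw [EuclideanSpace.real_norm_sq_eq, dotProduct]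
  exact Finset.sum_congr rfl fun i _ => by simp [sq]

theorem mulVec_dotProduct_self_le {A : Matrix (Fin n) (Fin n) ℝ} {c : ℝ} (hA : ‖A‖ ≤ c)
    (v : Fin n → ℝ) : (A *ᵥ v) ⬝ᵥ (A *ᵥ v) ≤ c ^ 2 * (v ⬝ᵥ v) := by
  rw [dotProduct_self_eq_norm_sq, dotProduct_self_eq_norm_sq, ← mul_pow]
  have h : ‖WithLp.toLp 2 (A *ᵥ v)‖ ≤ ‖A‖ * ‖WithLp.toLp 2 v‖ :=
    A.l2_opNorm_mulVec (WithLp.toLp 2 v)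
  gcongr
  exact h.trans (by gcongr)

theorem two_mul_dotProduct_le {κ : ℝ} (hκ : 0 < κ) (u v : Fin n → ℝ) :
    2 * (u ⬝ᵥ v) ≤ κ * (u ⬝ᵥ u) + κ⁻¹ * (v ⬝ᵥ v) := by
  simp only [dotProduct, Finset.mul_sum]
  rw [← Finset.sum_add_distrib]
  refine Finset.sum_le_sum fun i _ => ?_
  have h : 0 ≤ κ⁻¹ * (κ * u i - v i) ^ 2 := by positivity
  have : κ⁻¹ * (κ * u i - v i) ^ 2 = κ * (u i * u i) - 2 * (u i * v i) + κ⁻¹ * (v i * v i) := by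
    field_simp; ring
  linarith

theorem exists_two_mul_dotProduct_mulVec_le (A : Matrix (Fin n) (Fin n) ℝ) {κ : ℝ} (hκ : 0 < κ) :
    ∃ C, 0 ≤ C ∧ ∀ u δ : Fin n → ℝ, 2 * (u ⬝ᵥ A *ᵥ δ) ≤ κ * (u ⬝ᵥ u) + C * (δ ⬝ᵥ δ) := by
  refine ⟨κ⁻¹ * ‖A‖ ^ 2, by positivity, fun u δ => (two_mul_dotProduct_le hκ _ _).trans ?_⟩
  have := mul_le_mul_of_nonneg_left (mulVec_dotProduct_self_le (le_refl ‖A‖) δ)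
    (inv_nonneg.2 hκ.le)
  linarith

theorem dotProduct_transpose_mul_sq_mul_mulVec {D : Matrix (Fin n) (Fin n) ℝ} (hD : Dᵀ = D)
    (A C : Matrix (Fin n) (Fin n) ℝ) (u v : Fin n → ℝ) :
    u ⬝ᵥ (Aᵀ * D ^ 2 * C) *ᵥ v = (D *ᵥ A *ᵥ u) ⬝ᵥ (D *ᵥ C *ᵥ v) := by
  have h : Aᵀ * D ^ 2 * C = (D * A)ᵀ * (D * C) := by
    rw [transpose_mul, hD, sq]
    simp only [Matrix.mul_assoc]
  rw [h, ← mulVec_mulVec, dotProduct_mulVec, vecMul_transpose, mulVec_mulVec, mulVec_mulVec]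

theorem omega_quadraticForm (H : Matrix (Fin n) (Fin n) ℝ) (B : Matrix (Fin n) (Fin m) ℝ)
    (K : Matrix (Fin m) (Fin n) ℝ) {D : Matrix (Fin n) (Fin n) ℝ} (hD : Dᵀ = D)
    (μ ν α β₁ β₂ β₃ : ℝ) (x e w : Fin n → ℝ) :
    Sum.elim x (Sum.elim e w) ⬝ᵥ (Omega H B K D μ ν α β₁ β₂ β₃) *ᵥ Sum.elim x (Sum.elim e w)
      = (Real.exp (-μ) - ν ^ 2) * β₁ * ((D *ᵥ x) ⬝ᵥ (D *ᵥ x))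
        - 2 * β₁ * ((D *ᵥ H *ᵥ x + D *ᵥ (B * K) *ᵥ x) ⬝ᵥ (D *ᵥ (B * K) *ᵥ e))
        + 2 * α * β₃ * (e ⬝ᵥ e)
        - (β₁ + α ^ 2 * β₂) * ((D *ᵥ (B * K) *ᵥ e) ⬝ᵥ (D *ᵥ (B * K) *ᵥ e))
        + 2 * β₃ * (e ⬝ᵥ w) + 2 * (α * β₂) * ((D *ᵥ H *ᵥ w) ⬝ᵥ (D *ᵥ (B * K) *ᵥ e))
        + β₂ * ((Real.exp (-μ) - ν ^ 2) * ((D *ᵥ w) ⬝ᵥ (D *ᵥ w))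
          + (D *ᵥ (B * K) *ᵥ w) ⬝ᵥ (D *ᵥ (B * K) *ᵥ w)
          + 2 * ((D *ᵥ H *ᵥ w) ⬝ᵥ (D *ᵥ (B * K) *ᵥ w))) := by
  set F := B * K with hF
  have hsq : ∀ u v : Fin n → ℝ, u ⬝ᵥ (D ^ 2) *ᵥ v = (D *ᵥ u) ⬝ᵥ (D *ᵥ v) := fun u v => by
    simpa using dotProduct_transpose_mul_sq_mul_mulVec hD 1 1 u v
  have hQ := dotProduct_transpose_mul_sq_mul_mulVec hD F F
  have hG := dotProduct_transpose_mul_sq_mul_mulVec hD H F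
  have hQT : (Fᵀ * D ^ 2 * F)ᵀ = Fᵀ * D ^ 2 * F := by
    simp [transpose_mul, hD, Matrix.mul_assoc, transpose_pow]
  have hGT : (Hᵀ * D ^ 2 * F)ᵀ = Fᵀ * D ^ 2 * H := by
    simp [transpose_mul, hD, Matrix.mul_assoc, transpose_pow]
  have hGT₂ : (Fᵀ * D ^ 2 * H)ᵀ = Hᵀ * D ^ 2 * F := by rw [← hGT, transpose_transpose]
  have hGT' := dotProduct_transpose_mul_sq_mul_mulVec hD F H
  unfold Omega
  simp only [← hF, fromBlocks_mulVec, fromCols_mulVec, fromRows_mulVec,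
    Sum.elim_comp_inl, Sum.elim_comp_inr, zero_mulVec, add_zero,
    sumElim_dotProduct_sumElim, transpose_neg, transpose_smul, transpose_add, transpose_one,
    hQT, hGT, hGT₂, dotProduct_zero, Sum.elim_add_add, dotProduct_add, neg_mulVec, smul_mulVec,
    add_mulVec, sub_mulVec, dotProduct_sub, dotProduct_neg, dotProduct_smul, one_mulVec,
    smul_eq_mul, hsq, hQ, hG, hGT', add_dotProduct]
  rw [dotProduct_comm w e, dotProduct_comm (D *ᵥ F *ᵥ e) (D *ᵥ H *ᵥ x),
    dotProduct_comm (D *ᵥ F *ᵥ e) (D *ᵥ F *ᵥ x), dotProduct_comm (D *ᵥ F *ᵥ e) (D *ᵥ H *ᵥ w),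
    dotProduct_comm (D *ᵥ F *ᵥ w) (D *ᵥ H *ᵥ w)]
  ring

/-- With `F = BK`, expand `|Dv|²` around `D(H+F)x`, and write `|DHw|²` as `|D(H+F)w|² - 2⟨DHw, DFw⟩
- |DFw|²`. After the contraction bound on `D(H+F)`, the terms free of `δ` are exactly minus the form
of `Ω`, which is at least `ζ (|x|² + |e|² + |w|²)`. -/
theorem dissipation_inequality {H : Matrix (Fin n) (Fin n) ℝ} {B : Matrix (Fin n) (Fin m) ℝ}
    {K : Matrix (Fin m) (Fin n) ℝ} {D : Matrix (Fin n) (Fin n) ℝ}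
    {μ ν α β₁ β₂ β₃ ζ : ℝ} (hD_diag : D.IsDiag) (hD_pos : D.PosDef)
    (hβ₁ : 0 < β₁) (hβ₂ : 0 < β₂) (hζ : 0 < ζ)
    (hDν : ‖D * (H + B * K) * D⁻¹‖ ≤ ν)
    (hΩ : (Omega H B K D μ ν α β₁ β₂ β₃ - ζ • 1).PosDef) :
    ∃ C, 0 ≤ C ∧ ∀ x e w δ v v' : Fin n → ℝ, v = H *ᵥ x + (B * K) *ᵥ (x + e) →
      v' = H *ᵥ w + (B * K) *ᵥ (α • (δ - e)) →
      β₁ * ((D *ᵥ v) ⬝ᵥ (D *ᵥ v) - Real.exp (-μ) * ((D *ᵥ x) ⬝ᵥ (D *ᵥ x)))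
        + β₂ * ((D *ᵥ v') ⬝ᵥ (D *ᵥ v') - Real.exp (-μ) * ((D *ᵥ w) ⬝ᵥ (D *ᵥ w)))
        + β₃ * (2 * (e ⬝ᵥ (α • (δ - e) - w)))
      ≤ -(ζ / 2) * (e ⬝ᵥ e) + C * (δ ⬝ᵥ δ) := by
  set F := B * K with hF
  have hDT : Dᵀ = D := by
    rw [← hD_diag.diagonal_diag, diagonal_transpose]
  have hDdet : IsUnit D.det := (isUnit_iff_isUnit_det _).1 hD_pos.isUnit
  have hcontr : ∀ u : Fin n → ℝ, (D *ᵥ H *ᵥ u + D *ᵥ F *ᵥ u) ⬝ᵥ (D *ᵥ H *ᵥ u + D *ᵥ F *ᵥ u)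
      ≤ ν ^ 2 * ((D *ᵥ u) ⬝ᵥ (D *ᵥ u)) := by
    intro u
    have h := mulVec_dotProduct_self_le hDν (D *ᵥ u)
    have e : (D * (H + F) * D⁻¹) *ᵥ D *ᵥ u = D *ᵥ H *ᵥ u + D *ᵥ F *ᵥ u := by
      rw [mulVec_mulVec, Matrix.mul_assoc, nonsing_inv_mul _ hDdet, Matrix.mul_one,
        ← mulVec_mulVec, add_mulVec, mulVec_add]
    rwa [e] at h
  -- Young's inequality for the products with `δ`: the one with `w` may use all of `ζ |w|²`, the two
  -- with `e` use `ζ/4` each, which leaves `ζ/2` for the decay of `e`.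
  obtain ⟨C₁, hC₁, h1⟩ := exists_two_mul_dotProduct_mulVec_le ((α * β₂) • (Hᵀ * D ^ 2 * F)) hζ
  obtain ⟨C₂, hC₂, h2⟩ := exists_two_mul_dotProduct_mulVec_le
    (-(α ^ 2 * β₂) • (Fᵀ * D ^ 2 * F)) (show 0 < ζ / 4 by positivity)
  obtain ⟨C₃, hC₃, h3⟩ := exists_two_mul_dotProduct_mulVec_le
    ((α * β₃) • (1 : Matrix (Fin n) (Fin n) ℝ)) (show 0 < ζ / 4 by positivity)
  obtain ⟨C₄, hC₄, h4⟩ := exists_two_mul_dotProduct_mulVec_le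
    ((α ^ 2 * β₂) • (Fᵀ * D ^ 2 * F)) one_pos
  refine ⟨C₁ + C₂ + C₃ + (1 + C₄), by positivity, fun x e w δ v v' hv hv' => ?_⟩
  have hΩ' := hΩ.posSemidef.dotProduct_mulVec_nonneg (Sum.elim x (Sum.elim e w))
  rw [star_trivial, sub_mulVec, dotProduct_sub, omega_quadraticForm H B K hDT, smul_mulVec,
    one_mulVec, dotProduct_smul, sumElim_dotProduct_sumElim, sumElim_dotProduct_sumElim,
    smul_eq_mul, ← hF] at hΩ'
  have g1 := h1 w δ
  have g2 := h2 e δ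
  have g3 := h3 e δ
  have g4 := h4 δ δ
  simp only [smul_mulVec, dotProduct_smul, smul_eq_mul, one_mulVec,
    dotProduct_transpose_mul_sq_mul_mulVec hDT] at g1 g2 g3 g4
  have c1 := mul_le_mul_of_nonneg_left (hcontr x) hβ₁.le
  have c2 := mul_le_mul_of_nonneg_left (hcontr w) hβ₂.le
  have ev : D *ᵥ v = (D *ᵥ H *ᵥ x + D *ᵥ F *ᵥ x) + D *ᵥ F *ᵥ e := by
    rw [hv, mulVec_add, mulVec_add, mulVec_add, add_assoc]
  have ev' : D *ᵥ v' = D *ᵥ H *ᵥ w + α • (D *ᵥ F *ᵥ δ - D *ᵥ F *ᵥ e) := by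
    rw [hv', mulVec_add, mulVec_smul, mulVec_smul, mulVec_sub, mulVec_sub]
  rw [ev, ev']
  have hx : 0 ≤ ζ * (x ⬝ᵥ x) := mul_nonneg hζ.le
    (by rw [dotProduct_self_eq_norm_sq]; positivity)
  have hδ : 0 ≤ δ ⬝ᵥ δ := by rw [dotProduct_self_eq_norm_sq]; positivity
  have hδ₄ : 0 ≤ C₄ * (δ ⬝ᵥ δ) := mul_nonneg hC₄ hδ
  generalize D *ᵥ H *ᵥ x = a at *
  generalize D *ᵥ F *ᵥ x = a' at *
  generalize D *ᵥ F *ᵥ e = b at *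
  generalize D *ᵥ H *ᵥ w = p at *
  generalize D *ᵥ F *ᵥ w = q at *
  generalize D *ᵥ F *ᵥ δ = r at *
  generalize D *ᵥ x = x' at *
  generalize D *ᵥ w = w' at *
  simp only [add_dotProduct, dotProduct_add, sub_dotProduct, dotProduct_sub, smul_dotProduct,
    dotProduct_smul, smul_eq_mul] at *
  rw [dotProduct_comm a' a, dotProduct_comm q p] at *
  rw [dotProduct_comm b a, dotProduct_comm b a', dotProduct_comm b p, dotProduct_comm r p,
    dotProduct_comm r b]
  linarith

end Dissipation

end HyperbolicDSS

end

noncomputable section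

namespace HyperbolicDSS

/-! ### Decay of the Lyapunov functional -/

section Lyapunov

open Matrix

variable {n : ℕ}

/-- The integral of `k` over `[t - 1/l, t]` with weight `e^{-μ l (t - s)}`. -/
def windowEnergy (μ l : ℝ) (k : ℝ → ℝ) (t : ℝ) : ℝ :=
  Real.exp (-(μ * l * t)) * ∫ s in (t - 1 / l)..t, Real.exp (μ * l * s) * k s

/-- On the window `0 ≤ l * (t - s) ≤ 1`, so the weight lies between `e^{-μ}` and `1`. -/
theorem windowEnergy_bounds {μ l t : ℝ} {k : ℝ → ℝ} (hμ : 0 < μ) (hl : 0 < l) (hk0 : ∀ s, 0 ≤ k s)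
    (hk : IntervalIntegrable k volume (t - 1 / l) t) :
    Real.exp (-μ) * (∫ s in (t - 1 / l)..t, k s) ≤ windowEnergy μ l k t ∧
      windowEnergy μ l k t ≤ ∫ s in (t - 1 / l)..t, k s := by
  have hle : t - 1 / l ≤ t := by
    have : 0 < 1 / l := by positivity
    linarith
  have hi : IntervalIntegrable (fun s => Real.exp (-(μ * l * t)) * (Real.exp (μ * l * s) * k s))
      volume (t - 1 / l) t := (hk.continuousOn_mul (by fun_prop)).const_mul _
  unfold windowEnergy
  rw [← intervalIntegral.integral_const_mul, ← intervalIntegral.integral_const_mul]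
  have hexp : ∀ s, Real.exp (-(μ * l * t)) * (Real.exp (μ * l * s) * k s)
      = Real.exp (-(μ * l * (t - s))) * k s := fun s => by
    rw [← mul_assoc, ← Real.exp_add]; ring_nf
  constructor
  · refine intervalIntegral.integral_mono_on hle (hk.const_mul _) hi fun s hs => ?_
    rw [hexp]
    refine mul_le_mul_of_nonneg_right (Real.exp_le_exp.2 ?_) (hk0 s)
    have h1 : t - s ≤ 1 / l := by linarith [hs.1]
    rw [le_div_iff₀ hl] at h1
    nlinarith
  · refine intervalIntegral.integral_mono_on hle hi hk fun s hs => ?_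
    rw [hexp]
    refine mul_le_of_le_one_left (hk0 s) (Real.exp_le_one_iff.2 ?_)
    have : 0 ≤ μ * l * (t - s) := mul_nonneg (by positivity) (by linarith [hs.2])
    linarith

theorem windowEnergy_nonneg {μ l t : ℝ} {k : ℝ → ℝ} (hl : 0 < l) (hk0 : ∀ s, 0 ≤ k s) :
    0 ≤ windowEnergy μ l k t := by
  have hle : t - 1 / l ≤ t := by
    have : 0 < 1 / l := by positivity
    linarith
  exact mul_nonneg (Real.exp_pos _).le
    (intervalIntegral.integral_nonneg hle fun s _ => mul_nonneg (Real.exp_pos _).le (hk0 s))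

/-- The energy density of a trace and its derivative. -/
def traceDensity (β₁ β₂ : ℝ) (ψ : ℝ → ℝ) (s : ℝ) : ℝ := β₁ * ψ s ^ 2 + β₂ * deriv ψ s ^ 2

theorem traceDensity_nonneg {β₁ β₂ : ℝ} (hβ₁ : 0 < β₁) (hβ₂ : 0 < β₂) (ψ : ℝ → ℝ) (s : ℝ) :
    0 ≤ traceDensity β₁ β₂ ψ s := by
  unfold traceDensity; positivity

/-- The Lyapunov functional, in terms of the traces `ψ i` of the solution. -/
def lyapunov (D : Matrix (Fin n) (Fin n) ℝ) (l : Fin n → ℝ) (μ β₁ β₂ β₃ : ℝ)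
    (ψ η : Fin n → ℝ → ℝ) (t : ℝ) : ℝ :=
  (∑ i, D i i ^ 2 * windowEnergy μ (l i) (traceDensity β₁ β₂ (ψ i)) t)
    + β₃ * ∑ i, (η i t - ψ i (t - 1 / l i)) ^ 2

theorem mulVec_dotProduct_self_of_isDiag {D : Matrix (Fin n) (Fin n) ℝ} (hD : D.IsDiag)
    (u : Fin n → ℝ) : (D *ᵥ u) ⬝ᵥ (D *ᵥ u) = ∑ i, D i i ^ 2 * u i ^ 2 := by
  have h : ∀ i, (D *ᵥ u) i = D i i * u i := fun i => by
    conv_lhs => rw [← hD.diagonal_diag, mulVec_diagonal]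
    simp
  simp only [dotProduct, h]
  exact Finset.sum_congr rfl fun i _ => by ring

/-- `e^{κt} (V - C/κ)` is absolutely continuous with nonpositive derivative almost everywhere. -/
theorem HasACDeriv.gronwall {V V' : ℝ → ℝ} {κ C T : ℝ} (hV : HasACDeriv V V' 0 T) (hT : 0 ≤ T)
    (hκ : 0 < κ) (h : ∀ᵐ t, t ∈ Ioo 0 T → V' t ≤ -κ * V t + C) :
    V T ≤ Real.exp (-(κ * T)) * V 0 + C / κ * (1 - Real.exp (-(κ * T))) := by
  have hE : HasACDeriv (fun t => Real.exp (κ * t)) (fun t => κ * Real.exp (κ * t)) 0 T := by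
    refine HasACDeriv.of_hasDerivAt (by fun_prop) fun x => ?_
    have : HasDerivAt (fun t : ℝ => κ * t) κ x := by
      simpa using (hasDerivAt_id' x).const_mul κ
    simpa [mul_comm] using this.exp
  have hW := hE.mul (hV.sub (HasACDeriv.const (C / κ)))
  have := hW.le_of_deriv_nonpos hT (by
    filter_upwards [h] with t ht htI
    have h1 := ht htI
    have h2 : κ * Real.exp (κ * t) * (V t - C / κ) + Real.exp (κ * t) * (V' t - 0)
        = Real.exp (κ * t) * (κ * V t - C + V' t) := by field_simp; ring
    rw [h2]
    exact mul_nonpos_of_nonneg_of_nonpos (Real.exp_pos _).le (by linarith))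
  simp only [mul_zero, Real.exp_zero, one_mul] at this
  have h3 := mul_le_mul_of_nonneg_left this (Real.exp_pos (-(κ * T))).le
  rw [← mul_assoc, ← Real.exp_add, neg_add_cancel, Real.exp_zero, one_mul] at h3
  linarith

variable {D H F : Matrix (Fin n) (Fin n) ℝ} {l : Fin n → ℝ} {μ α β₁ β₂ β₃ T : ℝ}
  {ψ η δ : Fin n → ℝ → ℝ}

theorem intervalIntegrable_traceDensity {ψ : ℝ → ℝ} {a b : ℝ} (hab : a ≤ b)
    (hψ : HasACDeriv ψ (deriv ψ) a b)
    (hψ₂ : IntervalIntegrable (fun s => deriv ψ s ^ 2) volume a b) :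
    IntervalIntegrable (traceDensity β₁ β₂ ψ) volume a b := by
  refine IntervalIntegrable.add ?_ (hψ₂.const_mul β₂)
  apply ContinuousOn.intervalIntegrable
  rw [uIcc_of_le hab]
  exact ((hψ.continuousOn hab).pow 2).const_smul β₁

/-- A statement about the delay system alone. The windows decay at rates `μ * l i` and the
controller error through `ζ/2`; the two conditions on `κ` make it a common rate. -/
theorem lyapunov_decay {κ ζ C M : ℝ} (hT : 0 ≤ T) (hl : ∀ i, 0 < l i) (hκ : 0 < κ)
    (hκl : ∀ i, κ ≤ μ * l i) (hκβ : κ * β₃ ≤ ζ / 2)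
    (hβ₁ : 0 < β₁) (hβ₂ : 0 < β₂) (hD : D.IsDiag) (hC : 0 ≤ C)
    (hdiss : ∀ x e w δ v v' : Fin n → ℝ, v = H *ᵥ x + F *ᵥ (x + e) →
      v' = H *ᵥ w + F *ᵥ (α • (δ - e)) →
      β₁ * ((D *ᵥ v) ⬝ᵥ (D *ᵥ v) - Real.exp (-μ) * ((D *ᵥ x) ⬝ᵥ (D *ᵥ x)))
        + β₂ * ((D *ᵥ v') ⬝ᵥ (D *ᵥ v') - Real.exp (-μ) * ((D *ᵥ w) ⬝ᵥ (D *ᵥ w)))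
        + β₃ * (2 * (e ⬝ᵥ (α • (δ - e) - w)))
      ≤ -(ζ / 2) * (e ⬝ᵥ e) + C * (δ ⬝ᵥ δ))
    (hψ : ∀ i, HasACDeriv (ψ i) (deriv (ψ i)) (-(1 / l i)) T)
    (hψ₂ : ∀ i, IntervalIntegrable (fun s => deriv (ψ i) s ^ 2) volume (-(1 / l i)) T)
    (hη : ∀ i, HasACDeriv (η i) (fun t => α * (δ i t - (η i t - ψ i (t - 1 / l i)))) 0 T)
    (hbd : ∀ i, ∀ t ∈ Icc 0 T, ψ i t = (∑ j, H i j * ψ j (t - 1 / l j)) + ∑ j, F i j * η j t)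
    (hδ : ∀ᵐ t, t ∈ Ioo 0 T → ∑ i, δ i t ^ 2 ≤ M) :
    lyapunov D l μ β₁ β₂ β₃ ψ η T
      ≤ Real.exp (-(κ * T)) * lyapunov D l μ β₁ β₂ β₃ ψ η 0
        + C * M / κ * (1 - Real.exp (-(κ * T))) := by
  have hτ : ∀ i, 0 < 1 / l i := fun i => one_div_pos.2 (hl i)
  have hshift : ∀ i, HasACDeriv (fun t => ψ i (t - 1 / l i)) (fun t => deriv (ψ i) (t - 1 / l i))
      0 T := fun i => by
    have := ((hψ i).mono le_rfl (by linarith [hτ i] : -(1 / l i) ≤ T - 1 / l i)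
      (by linarith [hτ i])).comp_sub_const (by linarith [hτ i]) (1 / l i)
    simpa only [neg_add_cancel, sub_add_cancel] using this
  -- The boundary condition is differentiated in time and `η'` replaced by the controller equation.
  have hderiv : ∀ i, ∀ᵐ t, t ∈ Ioo 0 T → deriv (ψ i) t
      = (∑ j, H i j * deriv (ψ j) (t - 1 / l j))
        + ∑ j, F i j * (α * (δ j t - (η j t - ψ j (t - 1 / l j)))) := fun i => by
    have h1 := (HasACDeriv.sum Finset.univ fun j _ => (hshift j).const_mul (H i j)).add
      (HasACDeriv.sum Finset.univ fun j _ => (hη j).const_mul (F i j))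
    exact (h1.congr hT fun t ht => (hbd i t ht).symm).deriv_ae_eq
  have hwin : ∀ i, HasACDeriv (windowEnergy μ (l i) (traceDensity β₁ β₂ (ψ i)))
      (fun t => traceDensity β₁ β₂ (ψ i) t
        - Real.exp (-μ) * traceDensity β₁ β₂ (ψ i) (t - 1 / l i)
        - μ * l i * windowEnergy μ (l i) (traceDensity β₁ β₂ (ψ i)) t) 0 T := fun i => by
    have h := hasACDeriv_window (c := μ * l i) (hτ i).le hT
      (intervalIntegrable_traceDensity (β₁ := β₁) (β₂ := β₂) (by linarith [hτ i]) (hψ i) (hψ₂ i))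
    have e : μ * l i * (1 / l i) = μ := by
      have := (hl i).ne'
      field_simp
    rwa [e] at h
  have herr : ∀ i, HasACDeriv (fun t => (η i t - ψ i (t - 1 / l i)) ^ 2) (fun t =>
      2 * ((η i t - ψ i (t - 1 / l i)) * (α * (δ i t - (η i t - ψ i (t - 1 / l i)))
        - deriv (ψ i) (t - 1 / l i)))) 0 T := fun i => by
    have h1 := (hη i).sub (hshift i)
    refine ((h1.mul h1).congr hT fun t _ => (sq _).symm).congr_deriv (ae_of_all _ fun t _ => ?_)
    ring
  have hV := (HasACDeriv.sum Finset.univ fun i _ => (hwin i).const_mul (D i i ^ 2)).add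
    ((HasACDeriv.sum Finset.univ fun i _ => herr i).const_mul β₃)
  refine HasACDeriv.gronwall hV hT hκ ?_
  filter_upwards [ae_all_iff.2 hderiv, hδ] with t hdt hδt ht
  set x : Fin n → ℝ := fun i => ψ i (t - 1 / l i) with hx
  set w : Fin n → ℝ := fun i => deriv (ψ i) (t - 1 / l i) with hw
  set e : Fin n → ℝ := fun i => η i t - ψ i (t - 1 / l i) with he
  set δt : Fin n → ℝ := fun i => δ i t with hδt_def
  -- The inflow and its derivative play the roles of `v` and `v'`; `x + e` is `η`.
  have hd := hdiss x e w δt (fun i => ψ i t) (fun i => deriv (ψ i) t) (by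
    funext i
    rw [hbd i t (Ioo_subset_Icc_self ht)]
    simp [mulVec, dotProduct, hx, he]) (by
    funext i
    rw [hdt i ht]
    simp [mulVec, dotProduct, hw, he, hδt_def])
  simp only [mulVec_dotProduct_self_of_isDiag hD] at hd
  have hee : e ⬝ᵥ e = ∑ i, e i ^ 2 := Finset.sum_congr rfl fun i _ => (sq _).symm
  have hdd : δt ⬝ᵥ δt = ∑ i, δ i t ^ 2 := Finset.sum_congr rfl fun i _ => (sq _).symm
  have hcross : e ⬝ᵥ (α • (δt - e) - w) = ∑ i, e i * (α * (δ i t - e i) - w i) := rfl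
  rw [hee, hdd, hcross] at hd
  have hM : C * ∑ i, δ i t ^ 2 ≤ C * M := mul_le_mul_of_nonneg_left (hδt ht) hC
  have hwe : κ * ∑ i, D i i ^ 2 * windowEnergy μ (l i) (traceDensity β₁ β₂ (ψ i)) t
      ≤ ∑ i, D i i ^ 2 * (μ * l i * windowEnergy μ (l i) (traceDensity β₁ β₂ (ψ i)) t) := by
    rw [Finset.mul_sum]
    refine Finset.sum_le_sum fun i _ => ?_
    have h0 : 0 ≤ windowEnergy μ (l i) (traceDensity β₁ β₂ (ψ i)) t :=
      windowEnergy_nonneg (hl i) (traceDensity_nonneg hβ₁ hβ₂ _)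
    have := mul_le_mul_of_nonneg_right (hκl i) (mul_nonneg (sq_nonneg (D i i)) h0)
    linarith
  have hes : κ * β₃ * ∑ i, e i ^ 2 ≤ ζ / 2 * ∑ i, e i ^ 2 :=
    mul_le_mul_of_nonneg_right hκβ (Finset.sum_nonneg fun _ _ => sq_nonneg _)
  have hsplit : ∑ i, D i i ^ 2 * (traceDensity β₁ β₂ (ψ i) t
        - Real.exp (-μ) * traceDensity β₁ β₂ (ψ i) (t - 1 / l i)
        - μ * l i * windowEnergy μ (l i) (traceDensity β₁ β₂ (ψ i)) t)
      = β₁ * ((∑ i, D i i ^ 2 * ψ i t ^ 2) - Real.exp (-μ) * ∑ i, D i i ^ 2 * x i ^ 2)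
        + β₂ * ((∑ i, D i i ^ 2 * deriv (ψ i) t ^ 2) - Real.exp (-μ) * ∑ i, D i i ^ 2 * w i ^ 2)
        - ∑ i, D i i ^ 2 * (μ * l i * windowEnergy μ (l i) (traceDensity β₁ β₂ (ψ i)) t) := by
    simp only [Finset.mul_sum, ← Finset.sum_sub_distrib, ← Finset.sum_add_distrib]
    refine Finset.sum_congr rfl fun i _ => ?_
    simp only [traceDensity, hx, hw]
    ring
  have hlyap : lyapunov D l μ β₁ β₂ β₃ ψ η t
      = (∑ i, D i i ^ 2 * windowEnergy μ (l i) (traceDensity β₁ β₂ (ψ i)) t)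
        + β₃ * ∑ i, e i ^ 2 := rfl
  rw [hsplit, ← Finset.mul_sum, hlyap]
  change _ + β₃ * (2 * ∑ i, e i * (α * (δ i t - e i) - w i)) ≤ _
  linarith

end Lyapunov

end HyperbolicDSS

end

noncomputable section

namespace HyperbolicDSS

/-! ### Estimates for solutions -/

section Estimates

open Matrix

variable {n m : ℕ} {Λ H : Matrix (Fin n) (Fin n) ℝ} {B : Matrix (Fin n) (Fin m) ℝ}
  {K : Matrix (Fin m) (Fin n) ℝ} {α : ℝ} {d : ℝ → EuclideanSpace ℝ (Fin n)}
  {X₀ : ℝ → EuclideanSpace ℝ (Fin n)} {η₀ : EuclideanSpace ℝ (Fin n)}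
  {X : ℝ → ℝ → EuclideanSpace ℝ (Fin n)} {η : ℝ → EuclideanSpace ℝ (Fin n)}

theorem ae_norm_le_essSupNorm {t : ℝ} (hd : MemLp d ∞ (volume.restrict (Icc 0 t))) :
    ∀ᵐ s, s ∈ Icc 0 t → ‖d s‖ ≤ essSupNorm d t := by
  rw [← ae_restrict_iff' measurableSet_Icc]
  have hfin : eLpNorm d ∞ (volume.restrict (Icc 0 t)) ≠ ⊤ := hd.2.ne
  have := ae_le_eLpNormEssSup (f := d) (μ := volume.restrict (Icc 0 t))
  filter_upwards [this] with s hs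
  rw [← eLpNorm_exponent_top] at hs
  have h := ENNReal.toReal_mono hfin hs
  rwa [toReal_enorm] at h

theorem IsSolution.continuousOn_outflow (hX : IsSolution Λ H B K α d X₀ η₀ X η) :
    ContinuousOn (fun t => X t 1) (Ici 0) := by
  have h1 : ContinuousOn (fun t : ℝ => (t, (1 : ℝ))) (Ici 0) := by fun_prop
  exact hX.continuousOn_uncurry.comp h1 fun t ht => ⟨ht, right_mem_Icc.2 zero_le_one⟩

theorem IsSolution.controller_hasACDeriv (hX : IsSolution Λ H B K α d X₀ η₀ X η)
    (hΛ : Λ.IsDiag) (hl : ∀ i, 0 < Λ i i) {T : ℝ} (hT : 0 ≤ T)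
    (hd : MemLp d ∞ (volume.restrict (Icc 0 T))) (i : Fin n) :
    HasACDeriv (fun t => η t i)
      (fun t => α * (d t i - (η t i - trace X (Λ i i) i (t - 1 / Λ i i)))) 0 T := by
  have hint : IntegrableOn (fun s => (-α) • (η s - (X s 1 + d s))) (Icc 0 T) := by
    have h1 : IntegrableOn η (Icc 0 T) :=
      (hX.continuousOn_η.mono Icc_subset_Ici_self).integrableOn_compact isCompact_Icc
    have h2 : IntegrableOn (fun t => X t 1) (Icc 0 T) :=
      (hX.continuousOn_outflow.mono Icc_subset_Ici_self).integrableOn_compact isCompact_Icc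
    have h3 : IntegrableOn d (Icc 0 T) := hd.integrable le_top
    exact (h1.sub (h2.add h3)).smul (-α)
  have hAC : HasACDeriv (fun t => η t i) (fun s => ((-α) • (η s - (X s 1 + d s))) i) 0 T := by
    refine HasACDeriv.of_integral (c := η₀ i) hT ?_ fun t ht => ?_
    · rw [intervalIntegrable_iff_integrableOn_Icc_of_le hT]
      exact (EuclideanSpace.proj (𝕜 := ℝ) i).integrable_comp hint
    · have h := congrArg (fun v : EuclideanSpace ℝ (Fin n) => v i) (hX.controller t ht.1)
      simp only [PiLp.add_apply] at h
      rw [h, intervalIntegral.integral_of_le ht.1, intervalIntegral.integral_of_le ht.1,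
        setIntegral_euclidean_apply (hint.mono_set
          (Ioc_subset_Icc_self.trans (Icc_subset_Icc_right ht.2)))]
  refine hAC.congr_deriv (ae_of_all _ fun t ht => ?_)
  rw [← hX.apply_eq_trace hΛ i (hl i) ht.1.le (right_mem_Icc.2 zero_le_one)]
  simp only [PiLp.smul_apply, PiLp.sub_apply, PiLp.add_apply, smul_eq_mul]
  ring

theorem IsSolution.boundary_trace (hX : IsSolution Λ H B K α d X₀ η₀ X η)
    (hΛ : Λ.IsDiag) (hl : ∀ i, 0 < Λ i i) {t : ℝ} (ht : 0 ≤ t) (i : Fin n) :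
    trace X (Λ i i) i t = (∑ j, H i j * trace X (Λ j j) j (t - 1 / Λ j j))
      + ∑ j, (B * K) i j * η t j := by
  have h0 := hX.apply_eq_trace hΛ i (hl i) ht (left_mem_Icc.2 zero_le_one)
  rw [zero_div, sub_zero] at h0
  rw [← h0, hX.boundary t ht]
  have h1 : ∀ j, trace X (Λ j j) j (t - 1 / Λ j j) = X t 1 j := fun j =>
    (hX.apply_eq_trace hΛ j (hl j) ht (right_mem_Icc.2 zero_le_one)).symm
  simp only [h1]
  change (H *ᵥ (X t 1).ofLp + B *ᵥ K *ᵥ (η t).ofLp) i = _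
  rw [mulVec_mulVec]
  rfl

/-- `weakDeriv` is a choice, so it may differ between `f` and `g`; both choices agree almost
everywhere with the classical derivative. -/
theorem MemH1.h1NormSq_congr {f g : ℝ → EuclideanSpace ℝ (Fin n)} (hf : MemH1 f)
    (h : EqOn f g (Icc 0 1)) : h1NormSq f = h1NormSq g := by
  have hg := hf.congr h
  rw [hf.h1NormSq_eq, hg.h1NormSq_eq]
  refine Finset.sum_congr rfl fun i _ => ?_
  congr 1
  · refine intervalIntegral.integral_congr fun z hz => ?_
    rw [uIcc_of_le zero_le_one] at hz
    simp only [h hz]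
  · have h1 := hf.hasACDeriv i
    have h2 := (hg.hasACDeriv i).congr zero_le_one fun z hz =>
      show g z i = f z i by rw [h hz]
    refine intervalIntegral.integral_congr_ae ?_
    filter_upwards [HasACDeriv.ae_uIoc_of_ae_Ioo zero_le_one h1.deriv_ae_eq,
      HasACDeriv.ae_uIoc_of_ae_Ioo zero_le_one h2.deriv_ae_eq] with z e1 e2 hz
    rw [← e1 hz, ← e2 hz]

theorem IsSolution.integral_traceDensity (hX : IsSolution Λ H B K α d X₀ η₀ X η)
    (hΛ : Λ.IsDiag) {i : Fin n} (hl : 0 < Λ i i) {t : ℝ} (ht : 0 ≤ t) (β₁ β₂ : ℝ) :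
    IntervalIntegrable (traceDensity β₁ β₂ (trace X (Λ i i) i)) volume (t - 1 / Λ i i) t ∧
    ∫ s in (t - 1 / Λ i i)..t, traceDensity β₁ β₂ (trace X (Λ i i) i) s
      = β₁ / Λ i i * (∫ z in (0 : ℝ)..1, X t z i ^ 2)
        + β₂ * Λ i i * ∫ z in (0 : ℝ)..1, weakDeriv (X t) z i ^ 2 := by
  obtain ⟨hw1, hw2, hw3⟩ := hX.trace_window hΛ i hl ht
  have hle : t - 1 / Λ i i ≤ t := by
    have : 0 < 1 / Λ i i := by positivity
    linarith
  have hsq : IntervalIntegrable (fun s => trace X (Λ i i) i s ^ 2) volume (t - 1 / Λ i i) t := by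
    apply ContinuousOn.intervalIntegrable
    rw [uIcc_of_le hle]
    exact (hw1.continuousOn hle).pow 2
  refine ⟨intervalIntegrable_traceDensity hle hw1 hw2, ?_⟩
  simp only [traceDensity]
  rw [intervalIntegral.integral_add (hsq.const_mul _) (hw2.const_mul _),
    intervalIntegral.integral_const_mul, intervalIntegral.integral_const_mul, hw3,
    ← hX.integral_trace_sq hΛ i hl ht]
  field_simp

variable {D : Matrix (Fin n) (Fin n) ℝ} {μ β₁ β₂ β₃ : ℝ}

/-- The Lyapunov functional controls the supremum norm in space. -/
theorem exists_norm_sq_le_lyapunov (hl : ∀ i, 0 < Λ i i) (hΛ : Λ.IsDiag) (hDpos : ∀ i, 0 < D i i)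
    (hμ : 0 < μ) (hβ₁ : 0 < β₁) (hβ₂ : 0 < β₂) (hβ₃ : 0 < β₃) :
    ∃ C, 0 ≤ C ∧ ∀ {d X₀ η₀ X η}, IsSolution Λ H B K α d X₀ η₀ X η →
      ∀ t, 0 ≤ t → ∀ z ∈ Icc (0 : ℝ) 1, ‖X t z‖ ^ 2 ≤ C * lyapunov D (fun i => Λ i i) μ β₁ β₂ β₃
        (fun i => trace X (Λ i i) i) (fun i t => η t i) t := by
  -- The 2 is the Sobolev constant, the bracket undoes the weights `β₁ / Λ i i` and `β₂ * Λ i i` of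
  -- the L² norms, and the last factor undoes the lower window bound `e^{-μ}` and `D i i ^ 2`.
  set c : Fin n → ℝ := fun i =>
    2 * (Λ i i / β₁ + 1 / (β₂ * Λ i i)) * (Real.exp μ / D i i ^ 2) with hc
  have hc0 : ∀ i, 0 ≤ c i := fun i => by
    have := hl i
    have := hDpos i
    positivity
  refine ⟨∑ i, c i, Finset.sum_nonneg fun i _ => hc0 i, fun {d X₀ η₀ X η} hX t ht z hz => ?_⟩
  have hsum0 : ∀ i, 0 ≤ D i i ^ 2
      * windowEnergy μ (Λ i i) (traceDensity β₁ β₂ (trace X (Λ i i) i)) t := fun i =>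
    mul_nonneg (sq_nonneg _) (windowEnergy_nonneg (hl i) (traceDensity_nonneg hβ₁ hβ₂ _))
  have hle : ∀ i, D i i ^ 2 * windowEnergy μ (Λ i i) (traceDensity β₁ β₂ (trace X (Λ i i) i)) t
      ≤ lyapunov D (fun i => Λ i i) μ β₁ β₂ β₃
        (fun i => trace X (Λ i i) i) (fun i t => η t i) t := fun i => by
    have h1 := Finset.single_le_sum (fun j _ => hsum0 j) (Finset.mem_univ i)
    have h2 : 0 ≤ β₃ * ∑ i, (η t i - trace X (Λ i i) i (t - 1 / Λ i i)) ^ 2 :=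
      mul_nonneg hβ₃.le (Finset.sum_nonneg fun _ _ => sq_nonneg _)
    unfold lyapunov
    linarith
  rw [EuclideanSpace.real_norm_sq_eq, Finset.sum_mul]
  refine Finset.sum_le_sum fun i _ => ?_
  refine le_trans ?_ (mul_le_mul_of_nonneg_left (hle i) (hc0 i))
  have hmem := hX.memH1 t ht
  have h1 := (hmem.hasACDeriv i).sq_le one_pos (hmem.intervalIntegrable_weakDeriv_sq i) hz
  obtain ⟨h2, h3⟩ := hX.integral_traceDensity hΛ (hl i) ht β₁ β₂
  have h4 := (windowEnergy_bounds hμ (hl i) (traceDensity_nonneg hβ₁ hβ₂ _) h2).1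
  rw [h3] at h4
  set a := ∫ z in (0 : ℝ)..1, X t z i ^ 2
  set b := ∫ z in (0 : ℝ)..1, weakDeriv (X t) z i ^ 2
  have ha : 0 ≤ a := intervalIntegral.integral_nonneg zero_le_one fun _ _ => sq_nonneg _
  have hb : 0 ≤ b := intervalIntegral.integral_nonneg zero_le_one fun _ _ => sq_nonneg _
  set E := windowEnergy μ (Λ i i) (traceDensity β₁ β₂ (trace X (Λ i i) i)) t
  have hli := hl i
  have hDi := hDpos i
  have h5 : β₁ / Λ i i * a + β₂ * Λ i i * b ≤ Real.exp μ * E := by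
    have := mul_le_mul_of_nonneg_left h4 (Real.exp_pos μ).le
    rwa [← mul_assoc, ← Real.exp_add, add_neg_cancel, Real.exp_zero, one_mul] at this
  have h6 : 2 * (a + b) ≤ 2 * (Λ i i / β₁ + 1 / (β₂ * Λ i i))
      * (β₁ / Λ i i * a + β₂ * Λ i i * b) := by
    have e : 2 * (Λ i i / β₁ + 1 / (β₂ * Λ i i)) * (β₁ / Λ i i * a + β₂ * Λ i i * b)
        = 2 * (a + b) + 2 * (Λ i i / β₁ * (β₂ * Λ i i) * b
          + 1 / (β₂ * Λ i i) * (β₁ / Λ i i) * a) := by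
      field_simp
      ring
    rw [e]
    have : 0 ≤ Λ i i / β₁ * (β₂ * Λ i i) * b + 1 / (β₂ * Λ i i) * (β₁ / Λ i i) * a := by
      positivity
    linarith
  calc X t z i ^ 2 ≤ 2 * (a + b) := by linarith
    _ ≤ _ := h6
    _ ≤ 2 * (Λ i i / β₁ + 1 / (β₂ * Λ i i)) * (Real.exp μ * E) :=
      mul_le_mul_of_nonneg_left h5 (by positivity)
    _ = c i * (D i i ^ 2 * E) := by
      simp only [hc]
      field_simp

/-- The initial value of the Lyapunov functional is controlled by the initial data. -/
theorem exists_lyapunov_zero_le (hl : ∀ i, 0 < Λ i i) (hΛ : Λ.IsDiag)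
    (hμ : 0 < μ) (hβ₁ : 0 < β₁) (hβ₂ : 0 < β₂) (hβ₃ : 0 < β₃) :
    ∃ C, 0 ≤ C ∧ ∀ {d X₀ η₀ X η}, IsSolution Λ H B K α d X₀ η₀ X η →
      lyapunov D (fun i => Λ i i) μ β₁ β₂ β₃ (fun i => trace X (Λ i i) i) (fun i t => η t i) 0
        ≤ C * (h1NormSq X₀ + ‖η₀ - X 0 1‖ ^ 2) := by
  set c : Fin n → ℝ := fun i => D i i ^ 2 * (β₁ / Λ i i + β₂ * Λ i i) with hc
  have hc0 : ∀ i, 0 ≤ c i := fun i => by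
    have := hl i
    positivity
  have hcs : 0 ≤ ∑ i, c i := Finset.sum_nonneg fun i _ => hc0 i
  refine ⟨(∑ i, c i) + β₃, by positivity, fun {d X₀ η₀ X η} hX => ?_⟩
  have hη0 : η 0 = η₀ := by simpa using hX.controller 0 le_rfl
  have hmem := hX.memH1 0 le_rfl
  have herr : ∑ i, (η 0 i - trace X (Λ i i) i (0 - 1 / Λ i i)) ^ 2 = ‖η₀ - X 0 1‖ ^ 2 := by
    rw [EuclideanSpace.real_norm_sq_eq]
    refine Finset.sum_congr rfl fun i _ => ?_
    rw [← hX.apply_eq_trace hΛ i (hl i) le_rfl (right_mem_Icc.2 zero_le_one), hη0]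
    rfl
  have hnorm := hmem.h1NormSq_congr hX.initial
  have hterm0 : ∀ i, 0 ≤ (∫ z in (0 : ℝ)..1, X 0 z i ^ 2)
      + ∫ z in (0 : ℝ)..1, weakDeriv (X 0) z i ^ 2 := fun i =>
    add_nonneg (intervalIntegral.integral_nonneg zero_le_one fun _ _ => sq_nonneg _)
      (intervalIntegral.integral_nonneg zero_le_one fun _ _ => sq_nonneg _)
  have hN0 : 0 ≤ h1NormSq (X 0) := by
    rw [hmem.h1NormSq_eq]
    exact Finset.sum_nonneg fun i _ => hterm0 i
  have hwin : ∑ i, D i i ^ 2 * windowEnergy μ (Λ i i) (traceDensity β₁ β₂ (trace X (Λ i i) i)) 0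
      ≤ (∑ i, c i) * h1NormSq (X 0) := by
    rw [Finset.sum_mul]
    refine Finset.sum_le_sum fun i _ => ?_
    obtain ⟨h2, h3⟩ := hX.integral_traceDensity hΛ (hl i) le_rfl β₁ β₂
    have h4 := (windowEnergy_bounds hμ (hl i) (traceDensity_nonneg hβ₁ hβ₂ _) h2).2
    rw [h3] at h4
    have h5 : (∫ z in (0 : ℝ)..1, X 0 z i ^ 2) + (∫ z in (0 : ℝ)..1, weakDeriv (X 0) z i ^ 2)
        ≤ h1NormSq (X 0) := by
      rw [hmem.h1NormSq_eq]
      exact Finset.single_le_sum (fun j _ => hterm0 j) (Finset.mem_univ i)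
    have ha : 0 ≤ ∫ z in (0 : ℝ)..1, X 0 z i ^ 2 :=
      intervalIntegral.integral_nonneg zero_le_one fun _ _ => sq_nonneg _
    have hb : 0 ≤ ∫ z in (0 : ℝ)..1, weakDeriv (X 0) z i ^ 2 :=
      intervalIntegral.integral_nonneg zero_le_one fun _ _ => sq_nonneg _
    have hli := hl i
    refine le_trans ?_ (mul_le_mul_of_nonneg_left h5 (hc0 i))
    simp only [hc]
    rw [mul_assoc]
    refine mul_le_mul_of_nonneg_left (h4.trans ?_) (sq_nonneg _)
    have h6 : 0 ≤ β₁ / Λ i i := by positivity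
    have h7 : 0 ≤ β₂ * Λ i i := by positivity
    nlinarith [mul_nonneg h6 hb, mul_nonneg h7 ha]
  unfold lyapunov
  rw [herr, ← hnorm]
  nlinarith [mul_nonneg hβ₃.le hN0, mul_nonneg hcs (sq_nonneg ‖η₀ - X 0 1‖)]

theorem IsSolution.lyapunov_le {ζ κ C : ℝ} {t : ℝ} (hX : IsSolution Λ H B K α d X₀ η₀ X η)
    (hd : MemLp d ∞ (volume.restrict (Icc 0 t)))
    (hl : ∀ i, 0 < Λ i i) (hΛ : Λ.IsDiag) (hκ : 0 < κ) (hκl : ∀ i, κ ≤ μ * Λ i i)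
    (hκβ : κ * β₃ ≤ ζ / 2) (hβ₁ : 0 < β₁) (hβ₂ : 0 < β₂) (hD : D.IsDiag) (hC : 0 ≤ C)
    (hdiss : ∀ x e w δ v v' : Fin n → ℝ, v = H *ᵥ x + (B * K) *ᵥ (x + e) →
      v' = H *ᵥ w + (B * K) *ᵥ (α • (δ - e)) →
      β₁ * ((D *ᵥ v) ⬝ᵥ (D *ᵥ v) - Real.exp (-μ) * ((D *ᵥ x) ⬝ᵥ (D *ᵥ x)))
        + β₂ * ((D *ᵥ v') ⬝ᵥ (D *ᵥ v') - Real.exp (-μ) * ((D *ᵥ w) ⬝ᵥ (D *ᵥ w)))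
        + β₃ * (2 * (e ⬝ᵥ (α • (δ - e) - w)))
      ≤ -(ζ / 2) * (e ⬝ᵥ e) + C * (δ ⬝ᵥ δ)) (ht : 0 ≤ t) :
    lyapunov D (fun i => Λ i i) μ β₁ β₂ β₃ (fun i => trace X (Λ i i) i) (fun i t => η t i) t
      ≤ Real.exp (-(κ * t)) * lyapunov D (fun i => Λ i i) μ β₁ β₂ β₃
          (fun i => trace X (Λ i i) i) (fun i t => η t i) 0 + C / κ * essSupNorm d t ^ 2 := by
  have h := lyapunov_decay (δ := fun i t => d t i) (M := essSupNorm d t ^ 2) ht hl hκ hκl hκβ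
    hβ₁ hβ₂ hD hC hdiss (fun i => (hX.trace_hasACDeriv hΛ i (hl i) ht).1)
    (fun i => (hX.trace_hasACDeriv hΛ i (hl i) ht).2)
    (fun i => hX.controller_hasACDeriv hΛ hl ht hd i)
    (fun i s hs => hX.boundary_trace hΛ hl hs.1 i) (by
      filter_upwards [ae_norm_le_essSupNorm hd] with s hs hsI
      rw [← EuclideanSpace.real_norm_sq_eq]
      have := hs (Ioo_subset_Icc_self hsI)
      gcongr)
  have h1 : C * essSupNorm d t ^ 2 / κ * (1 - Real.exp (-(κ * t)))
      ≤ C * essSupNorm d t ^ 2 / κ * 1 :=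
    mul_le_mul_of_nonneg_left (by linarith [Real.exp_pos (-(κ * t))]) (by positivity)
  have h2 : C * essSupNorm d t ^ 2 / κ * 1 = C / κ * essSupNorm d t ^ 2 := by ring
  linarith

theorem sqrt_add_le (x y : ℝ) : √(x + y) ≤ √x + √y := by
  have h : ∀ x : ℝ, x ≤ √x ^ 2 := fun x => by
    -- The square root of a negative number is `0`, so no sign condition is needed.
    rcases le_total 0 x with hx | hx
    · exact (Real.sq_sqrt hx).ge
    · exact hx.trans (sq_nonneg _)
  refine Real.sqrt_le_iff.2 ⟨by positivity, ?_⟩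
  nlinarith [h x, h y, mul_nonneg (Real.sqrt_nonneg x) (Real.sqrt_nonneg y)]

theorem isClassKInfty_const_mul {g : ℝ} (hg : 0 < g) : IsClassKInfty fun r => g * r where
  continuousOn := by fun_prop
  strictMonoOn := fun _ _ _ _ h => mul_lt_mul_of_pos_left h hg
  map_zero := mul_zero g
  tendsto_atTop := tendsto_id.const_mul_atTop hg

end Estimates

end HyperbolicDSS

end

/-! ### The main theorem. -/

theorem theorem2 {n m : ℕ}
    (Λ H : Matrix (Fin n) (Fin n) ℝ) (B : Matrix (Fin n) (Fin m) ℝ)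
    (K : Matrix (Fin m) (Fin n) ℝ) (D : Matrix (Fin n) (Fin n) ℝ)
    (μ ν α β₁ β₂ β₃ ζ : ℝ)
    (hΛ_diag : Λ.IsDiag) (hΛ_pos : Λ.PosDef)
    (hD_diag : D.IsDiag) (hD_pos : D.PosDef)
    (hμ : 0 < μ) (hν : 0 < ν) (hα : 0 < α)
    (hβ₁ : 0 < β₁) (hβ₂ : 0 < β₂) (hβ₃ : 0 < β₃) (hζ : 0 < ζ)
    (hDν : ‖D * (H + B * K) * D⁻¹‖ ≤ ν) (hν_lt : ν < 1)
    (hΩ : (HyperbolicDSS.Omega H B K D μ ν α β₁ β₂ β₃ - ζ • 1).PosDef) :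
    ∃ a c : ℝ, ∃ γ : ℝ → ℝ, 0 < a ∧ 0 < c ∧ HyperbolicDSS.IsClassKInfty γ ∧
      ∀ (d : ℝ → EuclideanSpace ℝ (Fin n))
        (X₀ : ℝ → EuclideanSpace ℝ (Fin n)) (η₀ : EuclideanSpace ℝ (Fin n))
        (X : ℝ → ℝ → EuclideanSpace ℝ (Fin n)) (η : ℝ → EuclideanSpace ℝ (Fin n)),
        (∀ T : ℝ, MemLp d ∞ (volume.restrict (Icc 0 T))) →
        HyperbolicDSS.IsSolution Λ H B K α d X₀ η₀ X η →
        ∀ t : ℝ, 0 ≤ t → ∀ z ∈ Icc (0 : ℝ) 1,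
          ‖X t z‖ ≤
            c * Real.exp (-(a * t))
                * Real.sqrt (HyperbolicDSS.h1NormSq X₀ + ‖η₀ - X 0 1‖ ^ 2)
              + γ (HyperbolicDSS.essSupNorm d t) := by
  have hl : ∀ i, 0 < Λ i i := fun i => hΛ_pos.diag_pos
  obtain ⟨C, hC, hdiss⟩ := HyperbolicDSS.dissipation_inequality hD_diag hD_pos hβ₁ hβ₂ hζ hDν hΩ
  obtain ⟨C₁, hC₁, hsup⟩ := HyperbolicDSS.exists_norm_sq_le_lyapunov (H := H) (B := B) (K := K)
    (α := α) hl hΛ_diag (fun i => hD_pos.diag_pos) hμ hβ₁ hβ₂ hβ₃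
  obtain ⟨C₂, hC₂, hinit⟩ := HyperbolicDSS.exists_lyapunov_zero_le (D := D) (H := H) (B := B)
    (K := K) (α := α) hl hΛ_diag hμ hβ₁ hβ₂ hβ₃
  obtain ⟨κ, hκ, hκl, hκβ⟩ : ∃ κ, 0 < κ ∧ (∀ i, κ ≤ μ * Λ i i) ∧ κ * β₃ ≤ ζ / 2 := by
    obtain ⟨κ₀, hκ₀, hκ₀l⟩ : ∃ κ, 0 < κ ∧ ∀ i, κ ≤ μ * Λ i i := by
      -- For `n = 0` there is no slowest component and any positive rate will do.
      rcases isEmpty_or_nonempty (Fin n) with h | h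
      · exact ⟨1, one_pos, fun i => h.elim i⟩
      · obtain ⟨i, hi⟩ := Finite.exists_min fun i => μ * Λ i i
        exact ⟨μ * Λ i i, mul_pos hμ (hl i), hi⟩
    refine ⟨min κ₀ (ζ / (2 * β₃)), lt_min hκ₀ (by positivity),
      fun i => (min_le_left _ _).trans (hκ₀l i), ?_⟩
    calc min κ₀ (ζ / (2 * β₃)) * β₃ ≤ ζ / (2 * β₃) * β₃ := by gcongr; exact min_le_right _ _
      _ = ζ / 2 := by field_simp
  -- The functional is quadratic in `X`, so the rate is halved by the square root. The added `1`s
  -- keep `c` positive and `γ` strictly increasing when `C₁`, `C₂` or `C` vanishes.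
  refine ⟨κ / 2, √(C₁ * C₂) + 1, fun r => (√(C₁ * (C / κ)) + 1) * r, by positivity, by positivity,
    HyperbolicDSS.isClassKInfty_const_mul (by positivity), fun d X₀ η₀ X η hd hX t ht z hz => ?_⟩
  have h1 := hsup hX t ht z hz
  have h2 := hX.lyapunov_le (hd t) hl hΛ_diag hκ hκl hκβ hβ₁ hβ₂ hD_diag hC hdiss ht
  have h3 := hinit hX
  set M := HyperbolicDSS.h1NormSq X₀ + ‖η₀ - X 0 1‖ ^ 2
  set r := HyperbolicDSS.essSupNorm d t with hr
  have hr0 : 0 ≤ r := ENNReal.toReal_nonneg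
  have h4 : ‖X t z‖ ^ 2 ≤ Real.exp (-(κ * t)) * (C₁ * C₂ * M) + C₁ * (C / κ) * r ^ 2 := by
    refine h1.trans ((mul_le_mul_of_nonneg_left (h2.trans (add_le_add_left
      (mul_le_mul_of_nonneg_left h3 (Real.exp_pos _).le) _)) hC₁).trans (le_of_eq ?_))
    ring
  have h5 : √(Real.exp (-(κ * t)) * (C₁ * C₂ * M))
      = √(C₁ * C₂) * Real.exp (-(κ / 2 * t)) * √M := by
    rw [Real.sqrt_mul (Real.exp_pos _).le, Real.sqrt_mul (by positivity), ← Real.exp_half]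
    ring_nf
  have h6 : √(C₁ * (C / κ) * r ^ 2) = √(C₁ * (C / κ)) * r := by
    rw [Real.sqrt_mul (by positivity), Real.sqrt_sq hr0]
  calc ‖X t z‖ ≤ √(Real.exp (-(κ * t)) * (C₁ * C₂ * M) + C₁ * (C / κ) * r ^ 2) :=
        Real.le_sqrt_of_sq_le h4
    _ ≤ √(Real.exp (-(κ * t)) * (C₁ * C₂ * M)) + √(C₁ * (C / κ) * r ^ 2) :=
        HyperbolicDSS.sqrt_add_le _ _
    _ = √(C₁ * C₂) * Real.exp (-(κ / 2 * t)) * √M + √(C₁ * (C / κ)) * r := by rw [h5, h6]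
    _ ≤ (√(C₁ * C₂) + 1) * Real.exp (-(κ / 2 * t)) * √M + (√(C₁ * (C / κ)) + 1) * r := by
        gcongr <;> linarith
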